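/- Let $P\subset\mathbb R^2$ be a piecewise smooth Jordan loop, i.e. the image of a continuous, $1$-periodic map $\gamma:\mathbb R\to\mathbb R^2$ that is injective on $[0,1)$ and such that $[0,1]$ can be cut into finitely many closed intervals on each of which $\gamma$ is $C^1$ up to the ends. A labeled rectangle $R=(R_1,R_2,R_3,R_4)$ with sides of positive length *graces* $P$ if its vertices lie on $P$ and $\gamma$ meets them in the cyclic order $R_1,R_2,R_3,R_4$. Put $X(R)=|R_1R_2|$ and $Y(R)=|R_2R_3|$. Let $\alpha:[0,1]\to(\mathbb R^2)^4$, $t\mapsto R_t$, be a continuous path, piecewise $C^1$ in the same sense, such that $R_t$ graces $P$ for all $0<t<1$ (the ends $R_0,R_1$ may be degenerate), and let $Z(\alpha)$ be the shape curve $t\mapsto (X(R_t),Y(R_t))$. Call $\alpha$ - a *hyperbolic arc* if one endpoint of $Z(\alpha)$ lies on the $X$-axis, the other lies on the $Y$-axis, and neither is the origin; its shape loop is $Z(\alpha)$ closed up by the segments of the two coordinate axes that join its endpoints to the origin; - a *null arc* if both endpoints of $Z(\alpha)$ lie on the same coordinate axis and neither is the origin; its shape loop is $Z(\alpha)$ closed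 up by the segment of that axis between its endpoints; - a *closed loop* if $R_0=R_1$ as labeled rectangles and this rectangle graces $P$; its shape loop is $Z(\alpha)$. The signed area bounded by a closed piecewise smooth curve $c$ in the plane, embedded or not, is $\int_{\mathbb R^2} w(c,z)\,dz$, where $w(c,z)$ is the winding number of $c$ around $z$. Then in all three cases the function $z\mapsto w(c,z)$ of the shape loop $c$ is integrable, and: 1. if $\alpha$ is a hyperbolic arc, the signed area bounded by the shape loop equals, up to sign, the area of the region bounded by $P$ (the Lebesgue measure of the union of the bounded components of $\mathbb R^2\setminus P$); 2. if $\alpha$ is a null arc or a closed loop, the signed area bounded by the shape loop is $0$. -/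

import Mathlib

open MeasureTheory Set

/-- `f` is continuous on `[a, b]`, and `[a, b]` can be cut into finitely many closed intervals on
each of which `f` is continuously differentiable (with one-sided derivatives at the ends). -/
def PiecewiseSmoothOn {E : Type*} [NormedAddCommGroup E] [NormedSpace ℝ E]
    (f : ℝ → E) (a b : ℝ) : Prop :=
  ContinuousOn f (Icc a b) ∧
    ∃ (n : ℕ) (t : ℕ → ℝ), StrictMono t ∧ t 0 = a ∧ t n = b ∧
      ∀ i < n, ContDiffOn ℝ 1 f (Icc (t i) (t (i + 1)))

/-- A piecewise smooth Jordan loop in the plane `ℂ = ℝ²`, given by a `1`-periodic parametrization;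
the loop itself is `range γ`. Either direction of traversal is allowed. -/
structure IsPiecewiseSmoothJordanLoop (γ : ℝ → ℂ) : Prop where
  periodic : Function.Periodic γ 1
  injOn : InjOn γ (Ico 0 1)
  piecewiseSmooth : PiecewiseSmoothOn γ 0 1

/-- The region bounded by a compact planar set `P`: the points off `P` whose connected component
in the complement of `P` is bounded. -/
def boundedRegion (P : Set ℂ) : Set ℂ :=
  {z | z ∉ P ∧ Bornology.IsBounded (connectedComponentIn Pᶜ z)}

/-- Nondegenerate labeled rectangles: a parallelogram with perpendicular sides of positive length.
The vertices `R₁, R₂, R₃, R₄` are `R 0, R 1, R 2, R 3`. -/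
structure IsRectangle (R : Fin 4 → ℂ) : Prop where
  parallelogram : R 1 - R 0 = R 2 - R 3
  perpendicular : inner ℝ (R 1 - R 0) (R 2 - R 1) = 0
  first_ne : R 0 ≠ R 1
  second_ne : R 1 ≠ R 2

/-- The labeled rectangle `R` graces the loop `γ`: its vertices lie on the loop, and the loop
meets them in the cyclic order `R₁, R₂, R₃, R₄`. -/
def Graces (γ : ℝ → ℂ) (R : Fin 4 → ℂ) : Prop :=
  IsRectangle R ∧
    ∃ s : Fin 4 → ℝ, StrictMono s ∧ s 3 < s 0 + 1 ∧ ∀ j, γ (s j) = R j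

/-- The point `(X(R), Y(R))` formed by the lengths of the first and the second side of `R`. -/
noncomputable def shape (R : Fin 4 → ℂ) : ℂ :=
  ⟨dist (R 0) (R 1), dist (R 1) (R 2)⟩

/-- A point of the positive part of the `X`-axis. -/
def OnXAxis (z : ℂ) : Prop := 0 < z.re ∧ z.im = 0

/-- A point of the positive part of the `Y`-axis. -/
def OnYAxis (z : ℂ) : Prop := z.re = 0 ∧ 0 < z.im

/-- A piecewise smooth path, parametrized by `[0, 1]`, of rectangles gracing `γ`; the two ends
are allowed to be degenerate (limits of gracing rectangles). -/
structure IsGracingPath (γ : ℝ → ℂ) (α : ℝ → Fin 4 → ℂ) : Prop where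
  piecewiseSmooth : PiecewiseSmoothOn α 0 1
  graces : ∀ t ∈ Ioo (0 : ℝ) 1, Graces γ (α t)

/-- A closed loop of gracing rectangles. -/
def IsGracingLoop (γ : ℝ → ℂ) (α : ℝ → Fin 4 → ℂ) : Prop :=
  IsGracingPath γ α ∧ Graces γ (α 0) ∧ α 0 = α 1

/-- A path of gracing rectangles between two chords of the loop (rectangles with exactly one
vanishing side length) whose shape curve joins the two coordinate axes. -/
def IsHyperbolicArc (γ : ℝ → ℂ) (α : ℝ → Fin 4 → ℂ) : Prop :=
  IsGracingPath γ α ∧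
    ((OnXAxis (shape (α 0)) ∧ OnYAxis (shape (α 1))) ∨
      (OnYAxis (shape (α 0)) ∧ OnXAxis (shape (α 1))))

/-- A path of gracing rectangles between two chords of the loop whose shape curve starts and ends
on the same coordinate axis. -/
def IsNullArc (γ : ℝ → ℂ) (α : ℝ → Fin 4 → ℂ) : Prop :=
  IsGracingPath γ α ∧
    ((OnXAxis (shape (α 0)) ∧ OnXAxis (shape (α 1))) ∨
      (OnYAxis (shape (α 0)) ∧ OnYAxis (shape (α 1))))

/-- The shape curve `Z(α)`, for `t ∈ [0, 1]`. -/
noncomputable def shapeCurve (α : ℝ → Fin 4 → ℂ) (t : ℝ) : ℂ := shape (α t)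

/-- The shape loop of a hyperbolic arc, for `t ∈ [0, 3]`: the shape curve, then the segment of one
coordinate axis to the origin, then the segment of the other axis back to the starting point. -/
noncomputable def hyperbolicShapeLoop (α : ℝ → Fin 4 → ℂ) (t : ℝ) : ℂ :=
  if t ≤ 1 then shapeCurve α t
  else if t ≤ 2 then AffineMap.lineMap (shapeCurve α 1) 0 (t - 1)
  else AffineMap.lineMap 0 (shapeCurve α 0) (t - 2)

/-- The shape loop of a null arc, for `t ∈ [0, 2]`: the shape curve, then the segment of the
coordinate axis that contains both ends back to the starting point. -/
noncomputable def nullShapeLoop (α : ℝ → Fin 4 → ℂ) (t : ℝ) : ℂ :=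
  if t ≤ 1 then shapeCurve α t
  else AffineMap.lineMap (shapeCurve α 1) (shapeCurve α 0) (t - 1)

/-- The winding number `(1 / 2πi) ∮ dw / (w - z)` of the closed curve `c : [a, b] → ℂ` around the
point `z` off the curve. (The real part discards nothing there. The image of a piecewise smooth
curve is a null set, so the values on it play no role below.) -/
noncomputable def windingNumber (c : ℝ → ℂ) (a b : ℝ) (z : ℂ) : ℝ :=
  ((2 * Real.pi * Complex.I)⁻¹ * ∫ t in a..b, deriv c t / (c t - z)).re

/-- The (not necessarily embedded) closed curve `c : [a, b] → ℂ` bounds signed area `A`: every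
region of the complement is counted with the winding number of `c` around it. -/
def BoundsSignedArea (c : ℝ → ℂ) (a b A : ℝ) : Prop :=
  Integrable (windingNumber c a b) ∧ ∫ z, windingNumber c a b z = A

/-! The theorem is a statement about the form `x dy - y dx`. Its integral along a closed curve is
twice the signed area (`AlmostC1On.boundsSignedArea`): integrate the winding number over a large
disc, exchange the integrals, and use `∫_{|z|<R} dz/(w - z) = π · conj w`.

Write `a = R₂ - R₁ = X e^{iθ}` and `b = R₃ - R₂ = ε i Y e^{iθ}`. By continuity the orientation `ε =
±1` is constant along the path. The rotation speed `θ'` contributes only to the real parts of `conj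
a · b'` and `conj b · a'`, so `X dY - Y dX = ε (Im (conj a db) + Im (conj b da))`
(`mul_sub_mul_eq_of_perpendicular`). Since `R₄ = R₁ + R₃ - R₂`, the bracket is the alternating sum
of the area forms of the four vertices.

Each vertex moves on the loop, so the area it sweeps depends only on its initial and final
parameters, counted with full turns (`AlmostC1On.areaIntegral_comp`). The area swept by the shape
curve is therefore, up to sign, the change of `alternatingArea` between the ends. At a chord on the
`Y`-axis the parameters coincide in cancelling pairs and the value is `0`; at a chord on the
`X`-axis the fourth parameter is one turn ahead of the first, and the value is minus the integral
over the whole loop. For a closed loop of rectangles all four parameters change by the same integer,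
and nothing remains. The segments that close up the shape loop lie on lines through the origin and
sweep no area.

It remains to see that the integral over the loop gives the area of the bounded region, that is,
that the winding number is `0` or a constant `±1` according to the component. This follows from the
non-existence of certain continuous logarithms (`eq_zero_of_continuous_log`) and from the jump by
one across a regular point (`exists_windingNumber_sub_eq_one`). -/

/-! ### The integral of `1/(w - z)` over a disc -/

lemma circleAverage_inv_sub_of_lt {w : ℂ} {r : ℝ} (hr : 0 ≤ r) (h : r < ‖w‖) :
    Real.circleAverage (fun z : ℂ => (w - z)⁻¹) 0 r = w⁻¹ := by
  have hne : ∀ z ∈ Metric.closedBall (0 : ℂ) |r|, w - z ≠ 0 := by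
    intro z hz h0
    rw [abs_of_nonneg hr, mem_closedBall_zero_iff] at hz
    rw [sub_eq_zero] at h0
    subst h0
    linarith
  have := circleAverage_of_differentiable_on_off_countable (f := fun z : ℂ => (w - z)⁻¹) (c := 0)
    (R := r) (s := ∅) countable_empty
    (fun z hz => ContinuousAt.continuousWithinAt
      ((continuousAt_const.sub continuousAt_id).inv₀ (hne z hz)))
    (fun z hz => by
      have := hne z (Metric.ball_subset_closedBall hz.1)
      fun_prop (disch := assumption))
  simpa using this

/-- Since `(w - z)⁻¹ = w⁻¹ (1 - z/(z - w))`, this is Cauchy's formula for the constant `1`, by which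
`z/(z - w)` has average `1`. -/
lemma circleAverage_inv_sub_of_gt {w : ℂ} {r : ℝ} (hw : w ≠ 0) (h : ‖w‖ < r) :
    Real.circleAverage (fun z : ℂ => (w - z)⁻¹) 0 r = 0 := by
  have hr : 0 < r := (norm_nonneg w).trans_lt h
  have hc : DiffContOnCl ℂ (fun _ : ℂ => (1 : ℂ)) (Metric.ball 0 |r|) := diffContOnCl_const
  have h1 := hc.circleAverage_smul_div (w := w) (by simpa [abs_of_pos hr] using h)
  have h2 : Real.circleAverage (fun z : ℂ => (w - z)⁻¹) 0 r =
      Real.circleAverage (fun z : ℂ => w⁻¹ • ((1 : ℂ) - ((z - 0) / (z - w)) • (1 : ℂ))) 0 r := by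
    apply Real.circleAverage_congr_sphere
    intro z hz
    have hz' : z - w ≠ 0 := by
      intro h0
      rw [sub_eq_zero] at h0
      subst h0
      simp [abs_of_pos hr] at hz
      linarith
    have hz'' : w - z ≠ 0 := by rw [← neg_sub]; exact neg_ne_zero.2 hz'
    simp only [smul_eq_mul, sub_zero, mul_one]
    field_simp
    ring
  have hci : CircleIntegrable (fun z : ℂ => ((z - 0) / (z - w)) • (1 : ℂ)) 0 r := by
    apply ContinuousOn.circleIntegrable hr.le
    intro z hz
    have hz' : z - w ≠ 0 := by
      intro h0
      rw [sub_eq_zero] at h0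
      subst h0
      simp at hz
      linarith
    apply ContinuousAt.continuousWithinAt
    fun_prop (disch := assumption)
  rw [h2, Real.circleAverage_fun_smul, Real.circleAverage_fun_sub (circleIntegrable_const _ _ _) hci,
    h1, Real.circleAverage_const, sub_self, smul_zero]

lemma integrableOn_inv_sub (w : ℂ) (R : ℝ) :
    IntegrableOn (fun z : ℂ => (w - z)⁻¹) (Metric.ball 0 R) := by
  have h0 : LocallyIntegrable (fun z : ℂ => z⁻¹) := by
    refine locallyIntegrable_of_norm_le_rpow (C := 1) (α := 1) (by simp) (by simp) ?_
      measurable_inv.aestronglyMeasurable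
    filter_upwards with x
    simp [Real.rpow_neg_one]
  have h1 := (h0.integrableOn_isCompact (isCompact_closedBall (0 : ℂ) (‖w‖ + R)))
  have h2 : IntegrableOn (fun z : ℂ => (w - z)⁻¹)
      ((fun z => w - z) ⁻¹' (Metric.closedBall (0 : ℂ) (‖w‖ + R))) :=
    ((Measure.measurePreserving_sub_left volume w).integrableOn_comp_preimage
      (MeasurableEquiv.subLeft w).measurableEmbedding).2 h1
  refine h2.mono_set ?_
  intro z hz
  simp only [mem_ball_zero_iff, mem_preimage, mem_closedBall_zero_iff] at *
  exact (norm_sub_le _ _).trans (by linarith)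

lemma setIntegral_polar {f : ℂ → ℂ} (hf : Integrable f) (hm : Measurable f) :
    ∫ z, f z = ∫ r in Ioi (0 : ℝ), r • (2 * Real.pi) • Real.circleAverage f 0 r := by
  have key : IntegrableOn (fun p : ℝ × ℝ => p.1 • f (Complex.polarCoord.symm p))
      polarCoord.target := by
    have hmeas : Measurable (fun p : ℝ × ℝ => p.1 • f (Complex.polarCoord.symm p)) := by
      simp only [Complex.polarCoord_symm_apply]
      fun_prop
    refine ⟨hmeas.aestronglyMeasurable, ?_⟩
    have := Complex.lintegral_comp_polarCoord_symm (fun z => ‖f z‖ₑ)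
    rw [hasFiniteIntegral_iff_enorm]
    calc _ = ∫⁻ p in polarCoord.target, ENNReal.ofReal p.1 • ‖f (Complex.polarCoord.symm p)‖ₑ := by
          refine setLIntegral_congr_fun polarCoord.open_target.measurableSet ?_
          intro p hp
          have : 0 < p.1 := hp.1
          simp only [enorm_smul, Real.enorm_eq_ofReal this.le, smul_eq_mul]
      _ = _ := this
      _ < _ := hf.2
  rw [← Complex.integral_comp_polarCoord_symm]
  rw [polarCoord_target] at key ⊢
  rw [Measure.volume_eq_prod] at key ⊢
  rw [setIntegral_prod _ key]
  refine setIntegral_congr_fun measurableSet_Ioi ?_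
  intro r _
  simp only
  rw [integral_smul, Real.circleAverage, smul_smul (2 * Real.pi), mul_inv_cancel₀ (by positivity),
    one_smul, ← integral_Ioc_eq_integral_Ioo, ← intervalIntegral.integral_of_le (by linarith [Real.pi_pos])]
  have hp : Function.Periodic (fun θ => f (circleMap 0 r θ)) (2 * Real.pi) := by
    intro θ
    simp only [periodic_circleMap 0 r θ]
  have := hp.intervalIntegral_add_eq (-Real.pi) 0
  rw [zero_add, show -Real.pi + 2 * Real.pi = Real.pi by ring] at this
  rw [← this]
  congr 2 with θ
  simp [circleMap, Complex.exp_mul_I]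

/-- In polar coordinates the circles of radius larger than `‖w‖` contribute nothing and the smaller
ones average to `w⁻¹`, which leaves `π ‖w‖² / w`. -/
lemma integral_ball_inv_sub {w : ℂ} {R : ℝ} (hw : ‖w‖ < R) :
    ∫ z in Metric.ball (0 : ℂ) R, (w - z)⁻¹ = Real.pi * starRingEnd ℂ w := by
  by_cases hw0 : w = 0
  -- At the centre the integrand is odd.
  · subst hw0
    have h := integral_neg_eq_self ((Metric.ball (0 : ℂ) R).indicator fun z => (0 - z)⁻¹) volume
    have h2 : (fun z => (Metric.ball (0 : ℂ) R).indicator (fun z => (0 - z)⁻¹) (-z)) =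
        fun z => - (Metric.ball (0 : ℂ) R).indicator (fun z => (0 - z)⁻¹) z := by
      ext z
      simp only [indicator, mem_ball_zero_iff, norm_neg]
      split_ifs <;> simp [inv_neg]
    rw [h2, integral_neg, integral_indicator Metric.isOpen_ball.measurableSet] at h
    have : ∫ z in Metric.ball (0 : ℂ) R, (0 - z)⁻¹ = 0 := by
      have h3 : (2 : ℂ) * ∫ z in Metric.ball (0 : ℂ) R, (0 - z)⁻¹ = 0 := by
        linear_combination -h
      simpa using h3
    simpa using this
  rw [← integral_indicator Metric.isOpen_ball.measurableSet, setIntegral_polar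
    ((integrable_indicator_iff Metric.isOpen_ball.measurableSet).2 (integrableOn_inv_sub w R))
    (Measurable.indicator (by fun_prop) Metric.isOpen_ball.measurableSet)]
  have h1 : ∫ r in Ioi (0 : ℝ), r • (2 * Real.pi) • Real.circleAverage
      ((Metric.ball (0 : ℂ) R).indicator fun z => (w - z)⁻¹) 0 r =
      ∫ r in Ioi (0 : ℝ), (Iio ‖w‖).indicator (fun r => r • (2 * Real.pi) • w⁻¹) r := by
    -- The circle of radius `‖w‖` passes through the pole and is discarded.
    have hae : ∀ᵐ r : ℝ, r ≠ ‖w‖ := by simp [ae_iff, measure_singleton]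
    refine setIntegral_congr_ae measurableSet_Ioi ?_
    filter_upwards [hae] with r hr hr0
    have hr0 : 0 < r := hr0
    by_cases hrR : r < R
    · have h2 : Real.circleAverage ((Metric.ball (0 : ℂ) R).indicator fun z => (w - z)⁻¹) 0 r =
          Real.circleAverage (fun z => (w - z)⁻¹) 0 r := by
        apply Real.circleAverage_congr_sphere
        intro z hz
        simp [abs_of_pos hr0] at hz
        simp [indicator, hz, hrR]
      rw [h2]
      rcases lt_or_gt_of_ne hr with h | h
      · rw [circleAverage_inv_sub_of_lt hr0.le h, indicator_of_mem (show r ∈ Iio ‖w‖ from h)]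
      · rw [circleAverage_inv_sub_of_gt hw0 h, indicator_of_notMem (by simp [h.le])]
        simp
    · have h2 : Real.circleAverage ((Metric.ball (0 : ℂ) R).indicator fun z => (w - z)⁻¹) 0 r =
          Real.circleAverage (fun z => (0 : ℂ)) 0 r := by
        apply Real.circleAverage_congr_sphere
        intro z hz
        simp [abs_of_pos hr0] at hz
        simp [indicator, hz, hrR]
      rw [h2, indicator_of_notMem (by simp; linarith), Real.circleAverage_const]
      simp
  rw [h1, setIntegral_indicator measurableSet_Iio, Ioi_inter_Iio, ← integral_Ioc_eq_integral_Ioo,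
    ← intervalIntegral.integral_of_le (norm_nonneg w), intervalIntegral.integral_smul_const,
    integral_id]
  have hn : (‖w‖ : ℂ) ^ 2 = w * starRingEnd ℂ w := (Complex.mul_conj' w).symm
  simp only [Complex.real_smul]
  push_cast
  rw [hn]
  field_simp
  ring

/-! ### Curves that are continuously differentiable off a countable set -/

/-- A continuous plane curve that is continuously differentiable with bounded velocity off a
countable set of parameters between `a` and `b`. -/
structure AlmostC1On (c : ℝ → ℂ) (a b : ℝ) : Prop where
  continuousOn : ContinuousOn c (uIcc a b)
  exists_countable : ∃ s : Set ℝ, s.Countable ∧ ∃ M : ℝ, 0 ≤ M ∧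
    ∀ t ∈ Ioo (min a b) (max a b) \ s, ContDiffAt ℝ 1 c t ∧ ‖deriv c t‖ ≤ M

lemma ContDiffAt.hasDerivAt_one {c : ℝ → ℂ} {t : ℝ} (h : ContDiffAt ℝ 1 c t) :
    HasDerivAt c (deriv c t) t :=
  (h.differentiableAt one_ne_zero).hasDerivAt

lemma ContDiffAt.continuousAt_deriv_one {c : ℝ → ℂ} {t : ℝ} (h : ContDiffAt ℝ 1 c t) :
    ContinuousAt (deriv c) t := by
  have := (h.fderiv_right (m := 0) (by simp)).continuousAt
  exact this.clm_apply continuousAt_const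

lemma Ioo_min_max_ae {a b : ℝ} {s : Set ℝ} (hs : s.Countable) :
    ∀ᵐ t, t ∈ uIoc a b → t ∈ Ioo (min a b) (max a b) \ s := by
  have h1 : ∀ᵐ t : ℝ, t ∉ s := hs.ae_notMem _
  have h2 : ∀ᵐ t : ℝ, t ∉ ({max a b} : Set ℝ) := (countable_singleton _).ae_notMem _
  filter_upwards [h1, h2] with t h1 h2 ht
  exact ⟨⟨ht.1, lt_of_le_of_ne ht.2 h2⟩, h1⟩

namespace AlmostC1On
variable {c : ℝ → ℂ} {a b : ℝ}

lemma mono (h : AlmostC1On c a b) {a' b' : ℝ} (ha : a' ∈ uIcc a b) (hb : b' ∈ uIcc a b) :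
    AlmostC1On c a' b' := by
  obtain ⟨h1, s, hs, M, hM0, hM⟩ := h
  refine ⟨h1.mono (uIcc_subset_uIcc ha hb), s, hs, M, hM0, fun t ht => hM t ⟨?_, ht.2⟩⟩
  exact ⟨(le_min ha.1 hb.1).trans_lt ht.1.1, ht.1.2.trans_le (max_le ha.2 hb.2)⟩

lemma ae_norm_deriv_le (h : AlmostC1On c a b) :
    ∃ M : ℝ, 0 ≤ M ∧ ∀ᵐ t, t ∈ uIoc a b → ‖deriv c t‖ ≤ M := by
  obtain ⟨h1, s, hs, M, hM0, hM⟩ := h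
  refine ⟨M, hM0, ?_⟩
  filter_upwards [Ioo_min_max_ae (a := a) (b := b) hs] with t ht ht'
  exact (hM t (ht ht')).2

lemma intervalIntegrable_deriv (h : AlmostC1On c a b) :
    IntervalIntegrable (deriv c) volume a b := by
  obtain ⟨M, -, hM⟩ := h.ae_norm_deriv_le
  rw [intervalIntegrable_iff]
  refine Measure.integrableOn_of_bounded (M := M) (by simp)
    (measurable_deriv c).aestronglyMeasurable ?_
  exact (ae_restrict_iff' measurableSet_uIoc).2 hM

lemma integral_deriv (h : AlmostC1On c a b) : ∫ t in a..b, deriv c t = c b - c a := by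
  obtain ⟨s, hs, M, hM0, hM⟩ := h.exists_countable
  exact integral_eq_of_hasDerivAt_off_countable c _ hs h.continuousOn
    (fun t ht => (hM t ht).1.hasDerivAt_one) h.intervalIntegrable_deriv

lemma lipschitzOnWith (h : AlmostC1On c a b) : ∃ K, LipschitzOnWith K c (uIcc a b) := by
  obtain ⟨s, hs, M, hM0, hM⟩ := h.exists_countable
  refine ⟨⟨M, hM0⟩, LipschitzOnWith.of_dist_le_mul fun x hx y hy => ?_⟩
  have hm := h.mono hy hx
  rw [dist_eq_norm, ← hm.integral_deriv, Real.dist_eq]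
  refine intervalIntegral.norm_integral_le_of_norm_le_const_ae ?_
  filter_upwards [Ioo_min_max_ae (a := a) (b := b) hs] with t ht ht'
  exact (hM t (ht ⟨(le_min hy.1 hx.1).trans_lt ht'.1, ht'.2.trans (max_le hy.2 hx.2)⟩)).2

/-- A Lipschitz image of an interval has Hausdorff dimension at most `1`, which is less than `2`. -/
lemma volume_image (h : AlmostC1On c a b) : volume (c '' uIcc a b) = 0 := by
  obtain ⟨K, hK⟩ := h.lipschitzOnWith
  have h1 : dimH (c '' uIcc a b) ≤ 1 := by
    refine hK.dimH_image_le.trans ?_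
    exact (dimH_mono (subset_univ _)).trans Real.dimH_univ.le
  -- The set is moved to `ℝ × ℝ`, where two-dimensional Hausdorff measure is Lebesgue measure.
  have h2 : dimH (Complex.equivRealProdCLM '' (c '' uIcc a b)) ≤ 1 :=
    (Complex.equivRealProdCLM.lipschitz.dimH_image_le _).trans h1
  have h3 : volume (Complex.equivRealProdCLM '' (c '' uIcc a b)) = 0 := by
    rw [← hausdorffMeasure_prod_real]
    exact hausdorffMeasure_of_dimH_lt (d := 2) (h2.trans_lt (by norm_num))
  have h4 : c '' uIcc a b =
      Complex.measurableEquivRealProd ⁻¹' (Complex.equivRealProdCLM '' (c '' uIcc a b)) := by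
    ext z
    simp only [mem_preimage]
    rw [show (Complex.measurableEquivRealProd z) = Complex.equivRealProdCLM z from rfl,
      Complex.equivRealProdCLM.injective.mem_set_image]
  rw [h4, Complex.volume_preserving_equiv_real_prod.measure_preimage_equiv, h3]

lemma ae_notMem_image (h : AlmostC1On c a b) : ∀ᵐ z, z ∉ c '' uIcc a b :=
  compl_mem_ae_iff.2 h.volume_image

lemma intervalIntegrable_deriv_mul (h : AlmostC1On c a b) {g : ℝ → ℂ}
    (hg : ContinuousOn g (uIcc a b)) : IntervalIntegrable (fun t => deriv c t * g t) volume a b :=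
  h.intervalIntegrable_deriv.mul_continuousOn hg

lemma continuousOn_inv_sub (h : AlmostC1On c a b) {z : ℂ} (hz : z ∉ c '' uIcc a b) :
    ContinuousOn (fun t => (c t - z)⁻¹) (uIcc a b) :=
  (h.continuousOn.sub continuousOn_const).inv₀ fun t ht h0 => hz ⟨t, ht, by
    simpa [sub_eq_zero] using h0⟩

lemma intervalIntegrable_logDeriv (h : AlmostC1On c a b) {z : ℂ} (hz : z ∉ c '' uIcc a b) :
    IntervalIntegrable (fun t => deriv c t / (c t - z)) volume a b :=
  h.intervalIntegrable_deriv_mul (h.continuousOn_inv_sub hz)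

/-- If `L` is the primitive of the integrand, `exp (-L) * (c - z)` is continuous with zero
derivative off a countable set, hence constant. -/
lemma exp_integral_logDeriv (h : AlmostC1On c a b) {z : ℂ} (hz : z ∉ c '' uIcc a b) :
    Complex.exp (∫ t in a..b, deriv c t / (c t - z)) = (c b - z) / (c a - z) := by
  have hne : ∀ t ∈ uIcc a b, c t - z ≠ 0 := fun t ht h0 => hz ⟨t, ht, by
    simpa [sub_eq_zero] using h0⟩
  obtain ⟨s, hs, M, hM0, hM⟩ := h.exists_countable
  have hint := h.intervalIntegrable_logDeriv hz
  set L : ℝ → ℂ := fun u => ∫ t in a..u, deriv c t / (c t - z) with hL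
  have hLc : ContinuousOn L (uIcc a b) :=
    intervalIntegral.continuousOn_primitive_interval' hint left_mem_uIcc
  have hd : ∀ t ∈ Ioo (min a b) (max a b) \ s,
      HasDerivAt (fun u => Complex.exp (-L u) * (c u - z)) 0 t := by
    intro t ht
    have htI : t ∈ uIcc a b := ⟨ht.1.1.le, ht.1.2.le⟩
    have hC := (hM t ht).1
    have hnhds : uIoc a b ∈ nhds t :=
      Filter.mem_of_superset (Ioo_mem_nhds ht.1.1 ht.1.2) Ioo_subset_Ioc_self
    have hLd : HasDerivAt L (deriv c t / (c t - z)) t := by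
      refine intervalIntegral.integral_hasDerivAt_right
        (hint.mono_set (uIcc_subset_uIcc left_mem_uIcc htI))
        ⟨uIoc a b, hnhds, hint.def'.1⟩ ?_
      exact hC.continuousAt_deriv_one.div (hC.continuousAt.sub continuousAt_const) (hne t htI)
    have h1 := (hLd.neg.cexp).mul (hC.hasDerivAt_one.sub_const z)
    convert! h1 using 1
    have := hne t htI
    simp only [Pi.neg_apply]
    field_simp
    ring
  have hcont : ContinuousOn (fun u => Complex.exp (-L u) * (c u - z)) (uIcc a b) :=
    (Complex.continuous_exp.comp_continuousOn hLc.neg).mul (h.continuousOn.sub continuousOn_const)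
  have key := integral_eq_of_hasDerivAt_off_countable _ _ hs hcont hd (by simp)
  have hLa : L a = 0 := by simp [hL]
  simp only [intervalIntegral.integral_zero, hLa, neg_zero, Complex.exp_zero, one_mul] at key
  have hka := hne a left_mem_uIcc
  rw [eq_div_iff hka]
  rw [eq_comm, sub_eq_zero] at key
  rw [← key, ← mul_assoc, ← Complex.exp_add, add_neg_cancel, Complex.exp_zero, one_mul]

end AlmostC1On

/-! ### Green's formula in a disc, by Fubini -/

/-- The translate `w - ball 0 R` lies in `ball 0 (2 * R)`. The bound does not depend on `w`, which
is what integrability on the product needs. -/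
lemma setIntegral_norm_inv_sub_le {w : ℂ} {R : ℝ} (hw : ‖w‖ < R) :
    ∫ z in Metric.ball (0 : ℂ) R, ‖(w - z)⁻¹‖ ≤ ∫ z in Metric.ball (0 : ℂ) (2 * R), ‖z⁻¹‖ := by
  have h1 := (Measure.measurePreserving_sub_left volume w).setIntegral_preimage_emb
    (MeasurableEquiv.subLeft w).measurableEmbedding (fun z => ‖z⁻¹‖) (Metric.ball (0 : ℂ) (2 * R))
  rw [← h1]
  refine setIntegral_mono_set ?_ (by filter_upwards with x using by positivity) ?_
  · have h2 : IntegrableOn (fun z : ℂ => ‖z⁻¹‖) (Metric.ball 0 (2 * R)) := by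
      simpa [IntegrableOn] using (integrableOn_inv_sub 0 (2 * R)).norm
    exact ((Measure.measurePreserving_sub_left volume w).integrableOn_comp_preimage
      (MeasurableEquiv.subLeft w).measurableEmbedding).2 h2
  · refine Filter.Eventually.of_forall fun z hz => ?_
    have hz : z ∈ Metric.ball (0 : ℂ) R := hz
    show w - z ∈ Metric.ball (0 : ℂ) (2 * R)
    rw [mem_ball_zero_iff] at *
    exact (norm_sub_le _ _).trans_lt (by linarith)

namespace AlmostC1On
variable {c : ℝ → ℂ} {a b : ℝ}

lemma integrable_logDeriv_prod (h : AlmostC1On c a b) {R : ℝ}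
    (hR : ∀ t ∈ uIcc a b, ‖c t‖ < R) :
    Integrable (fun p : ℂ × ℝ => deriv c p.2 / (c p.2 - p.1))
      ((volume.restrict (Metric.ball 0 R)).prod (volume.restrict (uIoc a b))) := by
  have hcm : AEMeasurable c (volume.restrict (uIoc a b)) :=
    (h.continuousOn.mono uIoc_subset_uIcc).aemeasurable measurableSet_uIoc
  have hm : AEStronglyMeasurable (fun p : ℂ × ℝ => deriv c p.2 / (c p.2 - p.1))
      ((volume.restrict (Metric.ball 0 R)).prod (volume.restrict (uIoc a b))) := by
    refine AEMeasurable.aestronglyMeasurable ?_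
    exact ((measurable_deriv c).comp measurable_snd).aemeasurable.div
      ((hcm.comp_quasiMeasurePreserving Measure.quasiMeasurePreserving_snd).sub
        measurable_fst.aemeasurable)
  obtain ⟨M, hM0, hM⟩ := h.ae_norm_deriv_le
  have hae : ∀ᵐ t ∂(volume.restrict (uIoc a b)), ‖deriv c t‖ ≤ M ∧ ‖c t‖ < R := by
    rw [ae_restrict_iff' measurableSet_uIoc]
    filter_upwards [hM] with t ht ht'
    exact ⟨ht ht', hR t (uIoc_subset_uIcc ht')⟩
  rw [integrable_prod_iff' hm]
  constructor
  · refine Filter.Eventually.of_forall fun t => ?_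
    simp only [div_eq_mul_inv]
    exact (integrableOn_inv_sub (c t) R).const_mul _
  · have : IsFiniteMeasure (volume.restrict (uIoc a b)) := ⟨by simp⟩
    refine Integrable.of_bound hm.norm.prod_swap.integral_prod_right'
      (M * ∫ z in Metric.ball (0 : ℂ) (2 * R), ‖z⁻¹‖) ?_
    filter_upwards [hae] with t ht
    have h0 : 0 ≤ ∫ z in Metric.ball (0 : ℂ) R, ‖(c t - z)⁻¹‖ :=
      integral_nonneg fun _ => norm_nonneg _
    simp only [div_eq_mul_inv, norm_mul]
    rw [integral_const_mul, Real.norm_of_nonneg (mul_nonneg (norm_nonneg _) h0)]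
    exact mul_le_mul ht.1 (setIntegral_norm_inv_sub_le ht.2) h0 hM0

lemma integrableOn_integral_logDeriv (h : AlmostC1On c a b) {R : ℝ}
    (hR : ∀ t ∈ uIcc a b, ‖c t‖ < R) :
    IntegrableOn (fun z => ∫ t in a..b, deriv c t / (c t - z)) (Metric.ball 0 R) := by
  simp only [intervalIntegral.intervalIntegral_eq_integral_uIoc]
  exact (h.integrable_logDeriv_prod hR).integral_prod_left.smul (if a ≤ b then (1 : ℝ) else -1)

/-- **Green's formula** in a disc, for curves that need not be closed. -/
lemma setIntegral_integral_logDeriv (h : AlmostC1On c a b) {R : ℝ}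
    (hR : ∀ t ∈ uIcc a b, ‖c t‖ < R) :
    ∫ z in Metric.ball 0 R, (∫ t in a..b, deriv c t / (c t - z)) =
      Real.pi * ∫ t in a..b, deriv c t * starRingEnd ℂ (c t) := by
  simp only [intervalIntegral.intervalIntegral_eq_integral_uIoc]
  rw [integral_smul, integral_integral_swap (h.integrable_logDeriv_prod hR), mul_smul_comm,
    ← integral_const_mul]
  congr 1
  refine setIntegral_congr_fun measurableSet_uIoc fun t ht => ?_
  simp only [div_eq_mul_inv]
  rw [integral_const_mul, integral_ball_inv_sub (hR t (uIoc_subset_uIcc ht))]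
  ring

end AlmostC1On

/-! ### Continuous logarithms, winding numbers and signed area -/

lemma IsPreconnected.eq_of_forall_exists_int {X : Type*} [TopologicalSpace X] {S : Set X}
    (hS : IsPreconnected S) {f : X → ℝ} (hf : ContinuousOn f S)
    (h : ∀ x ∈ S, ∃ n : ℤ, f x = n) {x y : X} (hx : x ∈ S) (hy : y ∈ S) : f x = f y := by
  have hd : DiscreteTopology (range ((↑) : ℤ → ℝ)) :=
    (Int.isClosedEmbedding_coe_real.isEmbedding.toHomeomorph.symm.isEmbedding).discreteTopology
  refine hS.constant_of_mapsTo (T := range ((↑) : ℤ → ℝ)) ⟨hd⟩ hf (fun x hx => ?_) hx hy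
  obtain ⟨n, hn⟩ := h x hx
  exact ⟨n, hn.symm⟩

/-- Two continuous logarithms of one function differ by integer multiples of `2πi`, hence by a
constant on a preconnected set. Logarithms can thus be compared where only continuity is known. -/
lemma IsPreconnected.sub_eq_of_exp_eq {X : Type*} [TopologicalSpace X] {S : Set X}
    (hS : IsPreconnected S) {f g : X → ℂ} (hf : ContinuousOn f S) (hg : ContinuousOn g S)
    (h : ∀ x ∈ S, Complex.exp (f x) = Complex.exp (g x)) {x y : X} (hx : x ∈ S) (hy : y ∈ S) :
    f x - g x = f y - g y := by
  have hex : ∀ x ∈ S, ∃ n : ℤ, f x - g x = n * (2 * Real.pi * Complex.I) := by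
    intro x hx
    obtain ⟨n, hn⟩ := Complex.exp_eq_exp_iff_exists_int.1 (h x hx)
    exact ⟨n, by rw [hn]; ring⟩
  have hc : ContinuousOn (fun x => ((f x - g x) / (2 * Real.pi * Complex.I)).re) S :=
    Complex.continuous_re.comp_continuousOn ((hf.sub hg).div_const _)
  have hpi : (2 * Real.pi * Complex.I : ℂ) ≠ 0 := Complex.two_pi_I_ne_zero
  have key := hS.eq_of_forall_exists_int hc (fun x hx => by
    obtain ⟨n, hn⟩ := hex x hx
    exact ⟨n, by simp [hn, hpi]⟩) hx hy
  obtain ⟨n, hn⟩ := hex x hx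
  obtain ⟨m, hm⟩ := hex y hy
  simp only [hn, hm, mul_div_cancel_right₀ _ hpi, Complex.intCast_re, Int.cast_inj] at key
  rw [hn, hm, key]

namespace AlmostC1On
variable {c : ℝ → ℂ} {a b : ℝ}

lemma integral_logDeriv_eq_two_pi_I_mul (h : AlmostC1On c a b) (hab : c a = c b) {z : ℂ}
    (hz : z ∉ c '' uIcc a b) :
    ∃ n : ℤ, (∫ t in a..b, deriv c t / (c t - z)) = n * (2 * Real.pi * Complex.I) ∧
      windingNumber c a b z = n := by
  have h1 := h.exp_integral_logDeriv hz
  have hne : c b - z ≠ 0 := fun h0 => hz ⟨b, right_mem_uIcc, by simpa [sub_eq_zero] using h0⟩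
  rw [hab, div_self hne, Complex.exp_eq_one_iff] at h1
  obtain ⟨n, hn⟩ := h1
  refine ⟨n, hn, ?_⟩
  rw [windingNumber, hn, mul_comm, mul_assoc, mul_inv_cancel₀ Complex.two_pi_I_ne_zero, mul_one,
    Complex.intCast_re]

lemma integral_logDeriv_eq_windingNumber (h : AlmostC1On c a b) (hab : c a = c b) {z : ℂ}
    (hz : z ∉ c '' uIcc a b) :
    (∫ t in a..b, deriv c t / (c t - z)) = windingNumber c a b z * (2 * Real.pi * Complex.I) := by
  obtain ⟨n, hn, hw⟩ := h.integral_logDeriv_eq_two_pi_I_mul hab hz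
  rw [hn, hw, Complex.ofReal_intCast]

lemma continuousOn_primitive_logDeriv (h : AlmostC1On c a b) {z : ℂ} (hz : z ∉ c '' uIcc a b) :
    ContinuousOn (fun u => ∫ t in a..u, deriv c t / (c t - z)) (uIcc a b) :=
  intervalIntegral.continuousOn_primitive_interval' (h.intervalIntegrable_logDeriv hz)
    left_mem_uIcc

lemma exp_primitive_logDeriv (h : AlmostC1On c a b) {z : ℂ} (hz : z ∉ c '' uIcc a b) {u : ℝ}
    (hu : u ∈ uIcc a b) :
    Complex.exp (∫ t in a..u, deriv c t / (c t - z)) = (c u - z) / (c a - z) :=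
  (h.mono left_mem_uIcc hu).exp_integral_logDeriv
    fun hz' => hz (image_mono (uIcc_subset_uIcc left_mem_uIcc hu) hz')

/-- For `‖z‖ ≥ R` the curve `1 - c/z` stays in the right half-plane, where the principal logarithm
is a single-valued branch. -/
lemma windingNumber_eq_zero (h : AlmostC1On c a b) (hab : c a = c b) {R : ℝ}
    (hR : ∀ t ∈ uIcc a b, ‖c t‖ < R) {z : ℂ} (hz : z ∉ Metric.ball 0 R) :
    windingNumber c a b z = 0 := by
  have hzR : R ≤ ‖z‖ := by simpa using hz
  have hz' : z ∉ c '' uIcc a b := by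
    rintro ⟨t, ht, rfl⟩
    exact absurd (hR t ht) (not_lt.2 hzR)
  have hne : ∀ t ∈ uIcc a b, c t - z ≠ 0 := fun t ht h0 => hz' ⟨t, ht, by
    simpa [sub_eq_zero] using h0⟩
  have hz0 : z ≠ 0 := by
    rintro rfl
    have := hR a left_mem_uIcc
    have := norm_nonneg (c a)
    simp at hzR
    linarith
  have hslit : ∀ t ∈ uIcc a b, 1 - c t / z ∈ Complex.slitPlane := by
    intro t ht
    refine Or.inl ?_
    have h1 : ‖c t / z‖ < 1 := by
      rw [norm_div, div_lt_one (norm_pos_iff.2 hz0)]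
      exact (hR t ht).trans_le hzR
    have h2 := (Complex.re_le_norm (c t / z)).trans_lt h1
    simp only [Complex.sub_re, Complex.one_re]
    linarith
  have key := (isPreconnected_uIcc (a := a) (b := b)).sub_eq_of_exp_eq
    (f := fun u => (∫ t in a..u, deriv c t / (c t - z)) + Complex.log (1 - c a / z))
    (g := fun u => Complex.log (1 - c u / z))
    ((h.continuousOn_primitive_logDeriv hz').add continuousOn_const)
    ((continuousOn_const.sub (h.continuousOn.div_const z)).clog hslit) (fun u hu => by
      rw [Complex.exp_add, h.exp_primitive_logDeriv hz' hu,
        Complex.exp_log (Complex.slitPlane_ne_zero (hslit u hu)),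
        Complex.exp_log (Complex.slitPlane_ne_zero (hslit a left_mem_uIcc))]
      have := hne a left_mem_uIcc
      field_simp
      ring) left_mem_uIcc right_mem_uIcc
  rw [hab] at key
  simp only [intervalIntegral.integral_same, zero_add, sub_self, add_sub_cancel_right] at key
  rw [windingNumber, ← key]
  simp

lemma exists_norm_lt (h : AlmostC1On c a b) : ∃ R, ∀ t ∈ uIcc a b, ‖c t‖ < R := by
  obtain ⟨C, hC⟩ := isCompact_uIcc.exists_bound_of_continuousOn h.continuousOn
  exact ⟨C + 1, fun t ht => (hC t ht).trans_lt (lt_add_one C)⟩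

/-- **Green's formula** for the signed area bounded by a closed curve. -/
lemma boundsSignedArea (h : AlmostC1On c a b) (hab : c a = c b) :
    BoundsSignedArea c a b ((∫ t in a..b, deriv c t * starRingEnd ℂ (c t)).im / 2) := by
  obtain ⟨R, hR⟩ := h.exists_norm_lt
  have hout : ∀ z ∉ Metric.ball (0 : ℂ) R, windingNumber c a b z = 0 :=
    fun z hz => h.windingNumber_eq_zero hab hR hz
  have hi := (h.integrableOn_integral_logDeriv hR).const_mul (2 * Real.pi * Complex.I)⁻¹
  have hw : IntegrableOn (windingNumber c a b) (Metric.ball 0 R) := hi.re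
  refine ⟨(integrableOn_iff_integrable_of_support_subset fun z hz => ?_).1 hw, ?_⟩
  · by_contra hz'
    exact hz (hout z hz')
  rw [← setIntegral_eq_integral_of_forall_compl_eq_zero hout]
  have h2 : ∫ z in Metric.ball 0 R, windingNumber c a b z =
      (∫ z in Metric.ball 0 R, (2 * Real.pi * Complex.I)⁻¹ *
        ∫ t in a..b, deriv c t / (c t - z)).re := integral_re hi
  rw [h2, integral_const_mul, h.setIntegral_integral_logDeriv hR]
  set J := ∫ t in a..b, deriv c t * starRingEnd ℂ (c t)
  have hp : (Real.pi : ℂ) ≠ 0 := by exact_mod_cast Real.pi_ne_zero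
  have : (2 * Real.pi * Complex.I)⁻¹ * (Real.pi * J) = J * (-Complex.I) / (2 : ℝ) := by
    push_cast
    field_simp
    rw [Complex.I_sq]
    ring
  rw [this, Complex.div_ofReal_re]
  simp

/-- The area form has the same integral along a curve and along a continuous reparametrization
of it, even where the parameter change is not differentiable. -/
lemma integral_deriv_mul_conj_comp (h : AlmostC1On c a b) {g : ℝ → ℂ}
    (hg : ∀ u v, AlmostC1On g u v) {s : ℝ → ℝ} (hs : ContinuousOn s (uIcc a b))
    (hcs : ∀ t ∈ uIcc a b, c t = g (s t)) :
    ∫ t in a..b, deriv c t * starRingEnd ℂ (c t) =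
      ∫ t in s a..s b, deriv g t * starRingEnd ℂ (g t) := by
  obtain ⟨T₀, hT₀⟩ := isCompact_uIcc.exists_bound_of_continuousOn hs
  set T := |T₀|
  have hT : ∀ t ∈ uIcc a b, s t ∈ uIcc (-T) T := by
    intro t ht
    have h1 := (hT₀ t ht).trans (le_abs_self T₀)
    rw [Real.norm_eq_abs, abs_le] at h1
    rw [uIcc_of_le (by linarith [abs_nonneg T₀])]
    exact h1
  have hgT := hg (-T) T
  obtain ⟨R, hR⟩ := hgT.exists_norm_lt
  have hsub : uIcc (s a) (s b) ⊆ uIcc (-T) T :=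
    uIcc_subset_uIcc (hT a left_mem_uIcc) (hT b right_mem_uIcc)
  have h1 := h.setIntegral_integral_logDeriv (R := R)
    (fun t ht => by rw [hcs t ht]; exact hR _ (hT t ht))
  have h2 := (hg (s a) (s b)).setIntegral_integral_logDeriv (R := R) (fun t ht => hR _ (hsub ht))
  have hp : (Real.pi : ℂ) ≠ 0 := by exact_mod_cast Real.pi_ne_zero
  apply mul_left_cancel₀ hp
  rw [← h1, ← h2]
  -- As `s` is only continuous, substitution is not available. Green's formula has reduced the claim
  -- to an equality of logarithmic integrals for almost every `z`; both are continuous logarithms of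
  -- `(c u - z)/(c a - z)` that vanish at `u = a`.
  refine setIntegral_congr_ae Metric.isOpen_ball.measurableSet ?_
  filter_upwards [hgT.ae_notMem_image] with z hz _
  have hzc : z ∉ c '' uIcc a b := by
    rintro ⟨t, ht, rfl⟩
    exact hz ⟨s t, hT t ht, (hcs t ht).symm⟩
  have hprim : ContinuousOn (fun u => ∫ t in s a..u, deriv g t / (g t - z)) (uIcc (-T) T) :=
    intervalIntegral.continuousOn_primitive_interval' (hgT.intervalIntegrable_logDeriv hz)
      (hT a left_mem_uIcc)
  have key := (isPreconnected_uIcc (a := a) (b := b)).sub_eq_of_exp_eq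
    (f := fun u => ∫ t in a..u, deriv c t / (c t - z))
    (g := fun u => ∫ t in s a..s u, deriv g t / (g t - z))
    (h.continuousOn_primitive_logDeriv hzc) (hprim.comp hs hT) (fun u hu => by
      rw [h.exp_primitive_logDeriv hzc hu, (hg (s a) (s u)).exp_integral_logDeriv, hcs u hu,
        hcs a left_mem_uIcc]
      exact fun hz' => hz (image_mono
        (uIcc_subset_uIcc (hT a left_mem_uIcc) (hT u hu)) hz')) right_mem_uIcc left_mem_uIcc
  simpa [sub_eq_zero] using key

end AlmostC1On

/-! ### Regularity of the loop and lifting of paths to parameters -/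

lemma exists_mem_Ioo_succ {t : ℕ → ℝ} {n : ℕ} {x : ℝ} (h0 : t 0 < x) (hn : x < t n)
    (hx : ∀ i, x ≠ t i) : ∃ i < n, x ∈ Ioo (t i) (t (i + 1)) := by
  induction n with
  | zero => exact absurd h0 (not_lt.2 hn.le)
  | succ n ih =>
    rcases lt_or_gt_of_ne (hx n) with h | h
    · obtain ⟨i, hi, hx'⟩ := ih h
      exact ⟨i, hi.trans n.lt_succ_self, hx'⟩
    · exact ⟨n, n.lt_succ_self, h, hn⟩

lemma PiecewiseSmoothOn.exists_countable {E : Type*} [NormedAddCommGroup E] [NormedSpace ℝ E]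
    {f : ℝ → E} {a b : ℝ} (h : PiecewiseSmoothOn f a b) :
    ∃ s : Set ℝ, s.Countable ∧ ∃ M : ℝ, 0 ≤ M ∧
      ∀ t ∈ Ioo a b \ s, ContDiffAt ℝ 1 f t ∧ ‖deriv f t‖ ≤ M := by
  obtain ⟨-, n, t, ht, rfl, rfl, hd⟩ := h
  have hb : ∀ i < n, ∃ C, 0 ≤ C ∧ ∀ x ∈ Ioo (t i) (t (i + 1)), ‖deriv f x‖ ≤ C := by
    intro i hi
    have hlt : t i < t (i + 1) := ht i.lt_succ_self
    have hc := (hd i hi).continuousOn_derivWithin (uniqueDiffOn_Icc hlt) le_rfl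
    obtain ⟨C, hC⟩ := isCompact_Icc.exists_bound_of_continuousOn hc
    refine ⟨|C|, abs_nonneg C, fun x hx => ?_⟩
    rw [← derivWithin_of_mem_nhds (Icc_mem_nhds hx.1 hx.2)]
    exact (hC x (Ioo_subset_Icc_self hx)).trans (le_abs_self C)
  choose! C hC0 hC using hb
  refine ⟨range t, countable_range t, ∑ i ∈ Finset.range n, C i,
    Finset.sum_nonneg fun i hi => hC0 i (Finset.mem_range.1 hi), fun x hx => ?_⟩
  obtain ⟨i, hi, hxi⟩ := exists_mem_Ioo_succ hx.1.1 hx.1.2 fun i h => hx.2 ⟨i, h.symm⟩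
  refine ⟨((hd i hi).contDiffAt (Icc_mem_nhds hxi.1 hxi.2)), (hC i hi x hxi).trans ?_⟩
  exact Finset.single_le_sum (fun i hi => hC0 i (Finset.mem_range.1 hi)) (Finset.mem_range.2 hi)

namespace IsPiecewiseSmoothJordanLoop
variable {γ : ℝ → ℂ}

lemma eq_iff (hγ : IsPiecewiseSmoothJordanLoop γ) {x y : ℝ} :
    γ x = γ y ↔ ∃ n : ℤ, x = y + n := by
  constructor
  · intro h
    have hf : ∀ x : ℝ, γ (Int.fract x) = γ x := fun x => by
      have := hγ.periodic.sub_zsmul_eq ⌊x⌋ (x := x)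
      rwa [zsmul_eq_mul, mul_one, Int.self_sub_floor] at this
    have h1 : Int.fract x = Int.fract y := hγ.injOn ⟨Int.fract_nonneg x, Int.fract_lt_one x⟩
      ⟨Int.fract_nonneg y, Int.fract_lt_one y⟩ (by rw [hf, hf, h])
    obtain ⟨n, hn⟩ := Int.fract_eq_fract.1 h1
    exact ⟨n, by linarith⟩
  · rintro ⟨n, rfl⟩
    have := hγ.periodic.zsmul n y
    rwa [zsmul_eq_mul, mul_one] at this

/-- The loop as a map from the circle. -/
noncomputable def circleMap (hγ : IsPiecewiseSmoothJordanLoop γ) : AddCircle (1 : ℝ) → ℂ :=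
  hγ.periodic.lift

lemma circleMap_coe (hγ : IsPiecewiseSmoothJordanLoop γ) (x : ℝ) : hγ.circleMap x = γ x :=
  Function.Periodic.lift_coe _ _

lemma continuous_circleMap (hγ : IsPiecewiseSmoothJordanLoop γ) : Continuous hγ.circleMap := by
  have : Fact ((0 : ℝ) < 1) := ⟨one_pos⟩
  have h := AddCircle.liftIco_continuous (p := (1 : ℝ)) (a := 0) (f := γ)
    (by rw [hγ.periodic 0]) (by simpa using hγ.piecewiseSmooth.1)
  convert h
  ext x
  obtain ⟨y, hy, rfl⟩ := AddCircle.coe_image_Ico_eq (1 : ℝ) 0 ▸ mem_univ x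
  rw [hγ.circleMap_coe, AddCircle.liftIco_coe_apply hy]

lemma continuous (hγ : IsPiecewiseSmoothJordanLoop γ) : Continuous γ := by
  have : γ = fun x : ℝ => hγ.circleMap x := by
    ext x
    rw [hγ.circleMap_coe]
  rw [this]
  exact hγ.continuous_circleMap.comp (AddCircle.continuous_mk' 1)

lemma isClosedEmbedding_circleMap (hγ : IsPiecewiseSmoothJordanLoop γ) :
    Topology.IsClosedEmbedding hγ.circleMap := by
  have : Fact ((0 : ℝ) < 1) := ⟨one_pos⟩
  refine hγ.continuous_circleMap.isClosedEmbedding fun x y => ?_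
  induction x using QuotientAddGroup.induction_on with | H x =>
  induction y using QuotientAddGroup.induction_on with | H y =>
  intro h
  have h : γ x = γ y := by simpa only [← hγ.circleMap_coe] using h
  obtain ⟨n, rfl⟩ := hγ.eq_iff.1 h
  refine sub_eq_zero.1 ?_
  exact (AddCircle.coe_eq_zero_iff (p := (1 : ℝ)) (x := y + n - y)).2 ⟨n, by simp⟩

lemma range_circleMap (hγ : IsPiecewiseSmoothJordanLoop γ) : range hγ.circleMap = range γ := by
  ext z
  constructor
  · rintro ⟨x, rfl⟩
    induction x using QuotientAddGroup.induction_on with | H x =>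
    exact ⟨x, (hγ.circleMap_coe x).symm⟩
  · rintro ⟨x, rfl⟩
    exact ⟨x, hγ.circleMap_coe x⟩

lemma range_eq_image (hγ : IsPiecewiseSmoothJordanLoop γ) (a : ℝ) :
    range γ = γ '' uIcc a (a + 1) := by
  rw [uIcc_of_le (by linarith)]
  refine (hγ.periodic.image_Icc one_pos a).symm

lemma isCompact_range (hγ : IsPiecewiseSmoothJordanLoop γ) : IsCompact (range γ) := by
  rw [hγ.range_eq_image 0]
  exact isCompact_uIcc.image hγ.continuous

lemma exists_countable (hγ : IsPiecewiseSmoothJordanLoop γ) :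
    ∃ s : Set ℝ, s.Countable ∧ ∃ M : ℝ, 0 ≤ M ∧ ∀ t ∉ s, ContDiffAt ℝ 1 γ t ∧ ‖deriv γ t‖ ≤ M := by
  obtain ⟨s, hs, M, hM0, hM⟩ := hγ.piecewiseSmooth.exists_countable
  -- The integers are excluded as well, because the one-sided derivatives at the seam of the
  -- parametrization need not agree.
  refine ⟨⋃ n : ℤ, (fun x : ℝ => x + n) '' (s ∪ {0}),
    countable_iUnion fun n => (hs.union (countable_singleton 0)).image _, M, hM0, fun t ht => ?_⟩
  have hfr : Int.fract t ∈ Ioo (0 : ℝ) 1 \ s := by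
    have h1 : Int.fract t ∉ s ∪ {0} := fun h => ht (mem_iUnion.2 ⟨⌊t⌋, Int.fract t, h, by simp⟩)
    simp only [mem_union, mem_singleton_iff, not_or] at h1
    exact ⟨⟨lt_of_le_of_ne (Int.fract_nonneg t) (Ne.symm h1.2), Int.fract_lt_one t⟩, h1.1⟩
  have hsh : (fun x : ℝ => γ (x - ⌊t⌋)) = γ := by
    ext x
    exact hγ.eq_iff.2 ⟨-⌊t⌋, by push_cast; ring⟩
  obtain ⟨h1, h2⟩ := hM _ hfr
  rw [← Int.self_sub_floor] at h1 h2
  constructor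
  · have := ContDiffAt.comp t (g := γ) (f := fun x : ℝ => x - ⌊t⌋) h1 (by fun_prop)
    rwa [Function.comp_def, hsh] at this
  · rw [← deriv_comp_sub_const, hsh] at h2
    exact h2

lemma almostC1On (hγ : IsPiecewiseSmoothJordanLoop γ) (a b : ℝ) : AlmostC1On γ a b := by
  obtain ⟨s, hs, M, hM0, hM⟩ := hγ.exists_countable
  exact ⟨hγ.continuous.continuousOn, s, hs, M, hM0, fun t ht => hM t ht.2⟩

/-- The loop is homeomorphic to `ℝ/ℤ`, and paths lift through the covering `ℝ → ℝ/ℤ`; an integer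
translation gives the lift its prescribed value at `t₀`. -/
lemma exists_continuous_lift (hγ : IsPiecewiseSmoothJordanLoop γ) {R : ℝ → ℂ}
    (hR : ContinuousOn R (Icc 0 1)) (hmem : ∀ t ∈ Icc (0 : ℝ) 1, R t ∈ range γ) {t₀ σ : ℝ}
    (ht₀ : t₀ ∈ Icc (0 : ℝ) 1) (hσ : γ σ = R t₀) :
    ∃ s : ℝ → ℝ, Continuous s ∧ s t₀ = σ ∧ ∀ t ∈ Icc (0 : ℝ) 1, γ (s t) = R t := by
  set e := hγ.isClosedEmbedding_circleMap.isEmbedding.toHomeomorph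
  have hmem' : ∀ t : unitInterval, R t ∈ range hγ.circleMap := fun t => by
    rw [hγ.range_circleMap]; exact hmem t t.2
  let p : C(unitInterval, AddCircle (1 : ℝ)) :=
    ⟨fun t => e.symm ⟨R t, hmem' t⟩, by
      refine e.symm.continuous.comp (Continuous.subtype_mk ?_ _)
      exact continuousOn_iff_continuous_domRestrict.1 hR⟩
  have hp : ∀ t, hγ.circleMap (p t) = R t := fun t =>
    congrArg Subtype.val (e.apply_symm_apply ⟨R t, hmem' t⟩)
  obtain ⟨x₀, hx₀⟩ := QuotientAddGroup.mk_surjective (p 0)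
  obtain ⟨Γ, hΓ, -⟩ := (AddCircle.isCoveringMap_coe (1 : ℝ)).exists_path_lifts p x₀ hx₀.symm
  have hlift : ∀ t ∈ Icc (0 : ℝ) 1, γ (Γ (projIcc 0 1 zero_le_one t)) = R t := by
    intro t ht
    rw [projIcc_of_mem _ ht, ← hp ⟨t, ht⟩, ← hγ.circleMap_coe]
    exact congrArg hγ.circleMap (congrFun hΓ ⟨t, ht⟩)
  obtain ⟨n, hn⟩ := hγ.eq_iff.1 (hσ.trans (hlift t₀ ht₀).symm)
  refine ⟨fun t => Γ (projIcc 0 1 zero_le_one t) + n, ?_, hn.symm, fun t ht => ?_⟩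
  · exact (Γ.continuous.comp continuous_projIcc).add continuous_const
  · rw [← hlift t ht]
    exact hγ.eq_iff.2 ⟨n, rfl⟩

end IsPiecewiseSmoothJordanLoop

/-! ### Winding numbers on the complementary components -/

/-- A frontier point off `P` would have an open component of its own that meets the given one, so it
would lie in the latter, which is open. -/
lemma frontier_connectedComponentIn_compl_subset {P : Set ℂ} (hP : IsClosed P) (z : ℂ) :
    frontier (connectedComponentIn Pᶜ z) ⊆ P := by
  intro x hx
  by_contra hxP
  have hopen : ∀ y, IsOpen (connectedComponentIn Pᶜ y) := fun y =>
    hP.isOpen_compl.connectedComponentIn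
  have hx' : x ∈ connectedComponentIn Pᶜ x := mem_connectedComponentIn hxP
  obtain ⟨y, hyx, hyz⟩ := mem_closure_iff.1 hx.1 _ (hopen x) hx'
  rw [(hopen z).frontier_eq] at hx
  rw [connectedComponentIn_eq hyx, ← connectedComponentIn_eq hyz] at hx'
  exact hx.2 hx'

lemma exists_continuous_log (G : C(ℂ, ℂ)) (hG : ∀ z, G z ≠ 0) :
    ∃ h : C(ℂ, ℂ), ∀ z, Complex.exp (h z) = G z := by
  obtain ⟨h, ⟨-, hh⟩, -⟩ := Complex.isCoveringMapOn_exp.existsUnique_continuousMap_lifts G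
    (a₀ := 0) (e₀ := Complex.log (G 0)) (Complex.exp_log (hG 0)) hG
  exact ⟨h, congrFun hh⟩

/-- If a bounded component of the complement of the compact set `P` contains `z₁` but not `z₂`,
then `(p - z₁) ^ a * (p - z₂) ^ b` has a continuous logarithm on `P` only for `a = 0`. -/
lemma eq_zero_of_continuous_log {P : Set ℂ} (hP : IsClosed P) {z₁ z₂ : ℂ} (hz₁ : z₁ ∉ P)
    (hz₂ : z₂ ∉ P) (hb : Bornology.IsBounded (connectedComponentIn Pᶜ z₁))
    (hz₁₂ : z₂ ∉ connectedComponentIn Pᶜ z₁) {a b : ℤ} (ψ : C(P, ℂ))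
    (hψ : ∀ p : P, Complex.exp (ψ p) = (p - z₁) ^ a * (p - z₂) ^ b) : a = 0 := by
  classical
  set U := connectedComponentIn Pᶜ z₁ with hU
  have hUo : IsOpen U := hP.isOpen_compl.connectedComponentIn
  have hfr : frontier U ⊆ P := frontier_connectedComponentIn_compl_subset hP z₁
  have hz₁U : z₁ ∈ U := mem_connectedComponentIn hz₁
  obtain ⟨Ψ, hΨ⟩ := ψ.exists_restrict_eq hP
  have hz₂c : ∀ z ∈ closure U, z - z₂ ≠ 0 := by
    intro z hz h0
    rw [sub_eq_zero] at h0
    subst h0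
    exact hz₂ (hfr ⟨hz, by rwa [hUo.interior_eq]⟩)
  have hz₁c : ∀ z ∈ closure Uᶜ, z - z₁ ≠ 0 := by
    intro z hz h0
    rw [hUo.isClosed_compl.closure_eq] at hz
    rw [sub_eq_zero] at h0
    subst h0
    exact hz hz₁U
  -- Extend the logarithm to `Ψ` on the plane and glue `exp Ψ · (z - z₂)^(-b)` inside `U` to `(z -
  -- z₁)^a` outside. The two agree on the frontier, which lies in `P`, and neither vanishes on its
  -- side.
  have hG : Continuous
      (U.piecewise (fun z => Complex.exp (Ψ z) * (z - z₂) ^ (-b)) (fun z => (z - z₁) ^ a)) := by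
    refine continuous_piecewise ?_ ?_ ?_
    · intro z hz
      have h1 : Ψ z = ψ ⟨z, hfr hz⟩ := DFunLike.congr_fun hΨ ⟨z, hfr hz⟩
      have h2 := hz₂c z hz.1
      rw [h1, hψ, mul_assoc, ← zpow_add₀ h2]
      simp
    · exact (Complex.continuous_exp.comp Ψ.continuous).continuousOn.mul
        ((continuous_id.sub continuous_const).continuousOn.zpow₀ _ fun z hz => Or.inl (hz₂c z hz))
    · exact (continuous_id.sub continuous_const).continuousOn.zpow₀ _
        fun z hz => Or.inl (hz₁c z hz)
  obtain ⟨h, hh⟩ := exists_continuous_log ⟨_, hG⟩ (fun z => by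
    by_cases hz : z ∈ U
    · simp only [ContinuousMap.coe_mk, piecewise_eq_of_mem _ _ _ hz]
      exact mul_ne_zero (Complex.exp_ne_zero _) (zpow_ne_zero _ (hz₂c z (subset_closure hz)))
    · simp only [ContinuousMap.coe_mk, piecewise_eq_of_notMem _ _ _ hz]
      exact zpow_ne_zero _ (hz₁c z (subset_closure hz)))
  obtain ⟨R₀, hR₀⟩ := hb.subset_ball z₁
  -- The circle of radius `R` about `z₁` avoids `U`, so the glued function is `(z - z₁)^a` there and
  -- its logarithm gains `2πia` in one turn. A logarithm defined on the whole plane gains nothing.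
  set R := max R₀ 1
  have hR : 0 < R := by positivity
  have hRc : (R : ℂ) ≠ 0 := by exact_mod_cast hR.ne'
  have hout : ∀ θ : ℝ, z₁ + R * Complex.exp (θ * Complex.I) ∉ U := by
    intro θ hθ
    have h1 := hR₀ hθ
    rw [mem_ball_iff_norm, add_sub_cancel_left, norm_mul, Complex.norm_exp_ofReal_mul_I, mul_one,
      Complex.norm_real, Real.norm_of_nonneg hR.le] at h1
    exact absurd h1 (not_lt.2 (le_max_left _ _))
  have key := isPreconnected_univ.sub_eq_of_exp_eq (X := ℝ)
    (f := fun θ => h (z₁ + R * Complex.exp (θ * Complex.I)))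
    (g := fun θ => (a : ℂ) * (Complex.log R + θ * Complex.I))
    (by fun_prop) (by fun_prop) (fun θ _ => by
      rw [hh, ContinuousMap.coe_mk, piecewise_eq_of_notMem _ _ _ (hout θ), add_sub_cancel_left,
        Complex.exp_int_mul, Complex.exp_add, Complex.exp_log hRc])
    (mem_univ (0 : ℝ)) (mem_univ (2 * Real.pi))
  push_cast at key
  rw [Complex.exp_two_pi_mul_I, zero_mul, Complex.exp_zero] at key
  have h3 : (a : ℂ) * (2 * Real.pi * Complex.I) = 0 := by linear_combination key
  simpa [Complex.two_pi_I_ne_zero] using h3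

namespace AlmostC1On
variable {c : ℝ → ℂ} {a b : ℝ}

lemma continuousAt_windingNumber (h : AlmostC1On c a b) {z₀ : ℂ} (hz₀ : z₀ ∉ c '' uIcc a b) :
    ContinuousAt (windingNumber c a b) z₀ := by
  have hcl : IsClosed (c '' uIcc a b) := (isCompact_uIcc.image_of_continuousOn h.continuousOn).isClosed
  obtain ⟨d, hd, hball⟩ := Metric.isOpen_iff.1 hcl.isOpen_compl z₀ hz₀
  have hfar : ∀ t ∈ uIcc a b, d ≤ ‖c t - z₀‖ := fun t ht => by
    by_contra hlt
    exact hball (mem_ball_iff_norm.2 (not_le.1 hlt)) ⟨t, ht, rfl⟩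
  have hev : ∀ᶠ z in nhds z₀, ∀ t ∈ uIcc a b, d / 2 ≤ ‖c t - z‖ := by
    filter_upwards [Metric.ball_mem_nhds z₀ (half_pos hd)] with z hz t ht
    rw [mem_ball_iff_norm] at hz
    have h1 := norm_sub_le (c t - z) (z₀ - z)
    have h2 := hfar t ht
    rw [sub_sub_sub_cancel_right] at h1
    rw [norm_sub_rev z₀ z] at h1
    linarith
  refine Complex.continuous_re.continuousAt.comp (continuousAt_const.mul ?_)
  refine intervalIntegral.continuousAt_of_dominated_interval
    (bound := fun t => ‖deriv c t‖ * (d / 2)⁻¹) ?_ ?_ ?_ ?_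
  · filter_upwards [hcl.isOpen_compl.mem_nhds hz₀] with z hz
    exact (h.intervalIntegrable_logDeriv hz).def'.1
  · filter_upwards [hev] with z hz
    refine Filter.Eventually.of_forall fun t ht => ?_
    rw [div_eq_mul_inv, norm_mul, norm_inv]
    gcongr
    exact hz t (uIoc_subset_uIcc ht)
  · exact h.intervalIntegrable_deriv.norm.mul_const _
  · refine Filter.Eventually.of_forall fun t ht => ?_
    have hne : c t - z₀ ≠ 0 := fun h0 => by
      have := hfar t (uIoc_subset_uIcc ht)
      rw [h0, norm_zero] at this
      linarith
    exact continuousAt_const.div (continuousAt_const.sub continuousAt_id) hne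

lemma windingNumber_eq_of_isPreconnected (h : AlmostC1On c a b) (hab : c a = c b) {S : Set ℂ}
    (hS : IsPreconnected S) (hSc : S ⊆ (c '' uIcc a b)ᶜ) {z z' : ℂ} (hz : z ∈ S) (hz' : z' ∈ S) :
    windingNumber c a b z = windingNumber c a b z' :=
  hS.eq_of_forall_exists_int
    (fun _ hw => (h.continuousAt_windingNumber (hSc hw)).continuousWithinAt)
    (fun _ hw => (h.integral_logDeriv_eq_two_pi_I_mul hab (hSc hw)).imp fun _ hn => hn.2) hz hz'

end AlmostC1On

namespace IsPiecewiseSmoothJordanLoop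
variable {γ : ℝ → ℂ}

lemma image_uIcc (hγ : IsPiecewiseSmoothJordanLoop γ) : γ '' uIcc 0 1 = range γ := by
  simpa using (hγ.range_eq_image 0).symm

lemma apply_zero (hγ : IsPiecewiseSmoothJordanLoop γ) : γ 0 = γ 1 := by
  simpa using (hγ.periodic 0).symm

/-- Powers of `p - z₁` and `p - z₂` whose winding along the loop cancels have a continuous
logarithm on the loop. -/
lemma exists_log (hγ : IsPiecewiseSmoothJordanLoop γ) {z₁ z₂ : ℂ} (hz₁ : z₁ ∉ range γ)
    (hz₂ : z₂ ∉ range γ) {a b : ℤ}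
    (hab : a * windingNumber γ 0 1 z₁ + b * windingNumber γ 0 1 z₂ = 0) :
    ∃ ψ : C(range γ, ℂ), ∀ p, Complex.exp (ψ p) = (p - z₁) ^ a * (p - z₂) ^ b := by
  have : Fact ((0 : ℝ) < 1) := ⟨one_pos⟩
  have hc := hγ.almostC1On 0 1
  rw [← hγ.image_uIcc] at hz₁ hz₂
  have hne : ∀ z ∉ γ '' uIcc 0 1, ∀ t, γ t - z ≠ 0 := fun z hz t h0 => by
    rw [hγ.image_uIcc] at hz
    exact hz ⟨t, by simpa [sub_eq_zero] using h0⟩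
  set K := (γ 0 - z₁) ^ a * (γ 0 - z₂) ^ b with hK
  have hK0 : K ≠ 0 := mul_ne_zero (zpow_ne_zero _ (hne z₁ hz₁ 0)) (zpow_ne_zero _ (hne z₂ hz₂ 0))
  set L : ℝ → ℂ := fun u => a * (∫ t in (0 : ℝ)..u, deriv γ t / (γ t - z₁)) +
    b * (∫ t in (0 : ℝ)..u, deriv γ t / (γ t - z₂)) + Complex.log K with hL
  have hLc : ContinuousOn L (Icc 0 (0 + 1)) := by
    have h1 := hc.continuousOn_primitive_logDeriv hz₁
    have h2 := hc.continuousOn_primitive_logDeriv hz₂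
    rw [uIcc_of_le zero_le_one] at h1 h2
    rw [zero_add]
    exact ((continuousOn_const.mul h1).add (continuousOn_const.mul h2)).add continuousOn_const
  -- The relation between the winding numbers is what closes `L` up, so that it descends to the
  -- circle.
  have hL01 : L 0 = L (0 + 1) := by
    simp only [hL, zero_add, hc.integral_logDeriv_eq_windingNumber hγ.apply_zero hz₁,
      hc.integral_logDeriv_eq_windingNumber hγ.apply_zero hz₂, intervalIntegral.integral_same]
    have hab' : (a : ℂ) * windingNumber γ 0 1 z₁ + b * windingNumber γ 0 1 z₂ = 0 := by
      exact_mod_cast hab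
    linear_combination -(2 * Real.pi * Complex.I) * hab'
  have hexp : ∀ u ∈ Icc (0 : ℝ) 1, Complex.exp (L u) = (γ u - z₁) ^ a * (γ u - z₂) ^ b := by
    intro u hu
    rw [← uIcc_of_le zero_le_one] at hu
    simp only [hL]
    rw [Complex.exp_add, Complex.exp_add, Complex.exp_int_mul, Complex.exp_int_mul,
      Complex.exp_log hK0, hc.exp_primitive_logDeriv hz₁ hu, hc.exp_primitive_logDeriv hz₂ hu,
      hK, div_zpow, div_zpow]
    have h1 := zpow_ne_zero a (hne z₁ hz₁ 0)
    have h2 := zpow_ne_zero b (hne z₂ hz₂ 0)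
    field_simp
  set e := hγ.isClosedEmbedding_circleMap.isEmbedding.toHomeomorph
  have hrange : ∀ p ∈ range γ, p ∈ range hγ.circleMap := fun p hp => by rwa [hγ.range_circleMap]
  refine ⟨⟨fun p => AddCircle.liftIco 1 0 L (e.symm ⟨p, hrange p p.2⟩), ?_⟩, ?_⟩
  · exact (AddCircle.liftIco_continuous hL01 hLc).comp
      (e.symm.continuous.comp (continuous_subtype_val.subtype_mk _))
  · rintro ⟨p, hp⟩
    have hp' : p ∈ γ '' Ico 0 1 := by
      obtain ⟨x, rfl⟩ := hp
      exact ⟨Int.fract x, ⟨Int.fract_nonneg x, Int.fract_lt_one x⟩, hγ.eq_iff.2 ⟨-⌊x⌋, by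
        rw [← Int.self_sub_floor]; push_cast; ring⟩⟩
    obtain ⟨u, hu, rfl⟩ := hp'
    have h1 : e.symm ⟨γ u, hrange _ hp⟩ = (u : AddCircle (1 : ℝ)) := by
      rw [Homeomorph.symm_apply_eq]
      exact Subtype.ext (hγ.circleMap_coe u).symm
    rw [ContinuousMap.coe_mk, h1, AddCircle.liftIco_coe_apply (by simpa using hu)]
    exact hexp u (Ico_subset_Icc_self hu)

/-- If it vanished, `p - z` would have a continuous logarithm on the loop. The second point only has
to lie far away, its exponent being `0`. -/
lemma windingNumber_ne_zero (hγ : IsPiecewiseSmoothJordanLoop γ) {z : ℂ}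
    (hz : z ∈ boundedRegion (range γ)) : windingNumber γ 0 1 z ≠ 0 := by
  intro h0
  obtain ⟨R, hR⟩ := (hz.2.union hγ.isCompact_range.isBounded).subset_ball 0
  have hR0 : ((|R| : ℝ) : ℂ) ∉ Metric.ball (0 : ℂ) R := by
    simp [le_abs_self]
  obtain ⟨ψ, hψ⟩ := hγ.exists_log (a := 1) (b := 0) hz.1 (fun h => hR0 (hR (Or.inr h)))
    (by simp [h0])
  exact one_ne_zero (eq_zero_of_continuous_log hγ.isCompact_range.isClosed hz.1
    (fun h => hR0 (hR (Or.inr h))) hz.2 (fun h => hR0 (hR (Or.inl h))) ψ hψ)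

lemma exists_int_windingNumber (hγ : IsPiecewiseSmoothJordanLoop γ) {z : ℂ} (hz : z ∉ range γ) :
    ∃ n : ℤ, windingNumber γ 0 1 z = n := by
  rw [← hγ.image_uIcc] at hz
  exact ((hγ.almostC1On 0 1).integral_logDeriv_eq_two_pi_I_mul hγ.apply_zero hz).imp fun _ h => h.2

/-- With winding numbers `n₁`, `n₂` the exponents `n₂`, `-n₁` cancel the total winding, and
`eq_zero_of_continuous_log` then makes the first exponent `n₂` zero. -/
lemma windingNumber_eq_zero_of_notMem (hγ : IsPiecewiseSmoothJordanLoop γ) {z₁ z₂ : ℂ}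
    (hz₁ : z₁ ∈ boundedRegion (range γ)) (hz₂ : z₂ ∉ range γ)
    (h : z₂ ∉ connectedComponentIn (range γ)ᶜ z₁) : windingNumber γ 0 1 z₂ = 0 := by
  obtain ⟨n₁, hn₁⟩ := hγ.exists_int_windingNumber hz₁.1
  obtain ⟨n₂, hn₂⟩ := hγ.exists_int_windingNumber hz₂
  obtain ⟨ψ, hψ⟩ := hγ.exists_log (a := n₂) (b := -n₁) hz₁.1 hz₂
    (by rw [hn₁, hn₂]; push_cast; ring)
  rw [hn₂, eq_zero_of_continuous_log hγ.isCompact_range.isClosed hz₁.1 hz₂ hz₁.2 h ψ hψ,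
    Int.cast_zero]

lemma windingNumber_eq_of_mem_connectedComponentIn (hγ : IsPiecewiseSmoothJordanLoop γ) {z z' : ℂ}
    (hz : z ∉ range γ) (h : z' ∈ connectedComponentIn (range γ)ᶜ z) :
    windingNumber γ 0 1 z' = windingNumber γ 0 1 z := by
  refine (hγ.almostC1On 0 1).windingNumber_eq_of_isPreconnected hγ.apply_zero
    isPreconnected_connectedComponentIn ?_ h (mem_connectedComponentIn hz)
  rw [hγ.image_uIcc]
  exact connectedComponentIn_subset _ _

/-- The winding number is the same at all points of the bounded region. -/
lemma windingNumber_eq_of_mem (hγ : IsPiecewiseSmoothJordanLoop γ) {z z' : ℂ}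
    (hz : z ∈ boundedRegion (range γ)) (hz' : z' ∈ boundedRegion (range γ)) :
    windingNumber γ 0 1 z' = windingNumber γ 0 1 z := by
  by_cases h : z' ∈ connectedComponentIn (range γ)ᶜ z
  · exact hγ.windingNumber_eq_of_mem_connectedComponentIn hz.1 h
  · exact absurd (hγ.windingNumber_eq_zero_of_notMem hz hz'.1 h) (hγ.windingNumber_ne_zero hz')

lemma windingNumber_eq_zero (hγ : IsPiecewiseSmoothJordanLoop γ) {z : ℂ} (hz : z ∉ range γ)
    (hz' : z ∉ boundedRegion (range γ)) : windingNumber γ 0 1 z = 0 := by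
  have hc := hγ.almostC1On 0 1
  obtain ⟨R, hR⟩ := hc.exists_norm_lt
  have hunb : ¬ Bornology.IsBounded (connectedComponentIn (range γ)ᶜ z) := fun h => hz' ⟨hz, h⟩
  obtain ⟨z', hzz', hout⟩ := not_subset.1 fun hs => hunb (Metric.isBounded_ball.subset (s := _)
    (t := Metric.ball (0 : ℂ) R) hs)
  rw [← hγ.windingNumber_eq_of_mem_connectedComponentIn hz hzz']
  exact hc.windingNumber_eq_zero hγ.apply_zero hR hout

end IsPiecewiseSmoothJordanLoop

/-! ### The jump across the loop and the area of the bounded region -/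

namespace IsPiecewiseSmoothJordanLoop
variable {γ : ℝ → ℂ}

/-- Otherwise `γ 0 = γ (1 / 2)`, against injectivity. -/
lemma exists_deriv_ne_zero (hγ : IsPiecewiseSmoothJordanLoop γ) :
    ∃ t, HasDerivAt γ (deriv γ t) t ∧ deriv γ t ≠ 0 := by
  by_contra! hcon
  obtain ⟨s, hs, M, -, hM⟩ := hγ.exists_countable
  have h0 : ∫ t in (0 : ℝ)..(1 / 2), deriv γ t = 0 := by
    refine intervalIntegral.integral_zero_ae ?_
    filter_upwards [hs.ae_notMem volume] with t ht _
    exact hcon t (hM t ht).1.hasDerivAt_one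
  rw [(hγ.almostC1On 0 (1 / 2)).integral_deriv, sub_eq_zero] at h0
  have := hγ.injOn (by norm_num) (by norm_num) h0
  norm_num at this

lemma windingNumber_shift (hγ : IsPiecewiseSmoothJordanLoop γ) (a : ℝ) (z : ℂ) :
    windingNumber γ a (a + 1) z = windingNumber γ 0 1 z := by
  have hd : Function.Periodic (deriv γ) 1 := fun t => by
    rw [← deriv_comp_add_const, hγ.periodic.funext]
  have hp : Function.Periodic (fun t => deriv γ t / (γ t - z)) 1 := fun t => by
    simp only [hd t, hγ.periodic t]
  rw [windingNumber, hp.intervalIntegral_add_eq a 0, zero_add, windingNumber]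

/-- In suitable complex coordinates around a regular point, the loop crosses a small segment
transversal to it exactly once. -/
lemma exists_transversal (hγ : IsPiecewiseSmoothJordanLoop γ) {t₀ : ℝ}
    (hd : HasDerivAt γ (deriv γ t₀) t₀) (h0 : deriv γ t₀ ≠ 0) :
    ∃ ε > 0, ∃ δ > 0, ε < 1 / 2 ∧
      (∀ t ∈ Ioo t₀ (t₀ + ε), 0 < ((γ t - γ t₀) / deriv γ t₀).re) ∧
      (∀ t ∈ Ioo (t₀ + 1 - ε) (t₀ + 1), ((γ t - γ t₀) / deriv γ t₀).re < 0) ∧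
      ∀ t ∈ Icc (t₀ + ε) (t₀ + 1 - ε), δ < ‖(γ t - γ t₀) / deriv γ t₀‖ := by
  set η : ℝ → ℂ := fun t => (γ t - γ t₀) / deriv γ t₀ with hη
  have hηd : HasDerivAt (fun t => (η t).re) 1 t₀ := by
    have h1 : HasDerivAt η 1 t₀ := by
      simpa [h0] using (hd.sub_const (γ t₀)).div_const (deriv γ t₀)
    have h2 := Complex.reCLM.hasFDerivAt.comp_hasDerivAt t₀ h1
    simpa only [Complex.reCLM_apply, Complex.one_re, Function.comp_def] using h2
  have hη0 : η t₀ = 0 := by simp [hη]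
  have hsl := hasDerivAt_iff_tendsto_slope.1 hηd
  have hev : ∀ᶠ t in nhdsWithin t₀ {t₀}ᶜ, 0 < slope (fun t => (η t).re) t₀ t :=
    hsl.eventually (lt_mem_nhds one_pos)
  rw [eventually_nhdsWithin_iff, Metric.eventually_nhds_iff] at hev
  obtain ⟨ε₀, hε₀, hball⟩ := hev
  -- The bound `1 / 4` keeps the middle parameter interval nonempty, so the norm attains a minimum
  -- there; injectivity makes it positive.
  set ε := min ε₀ (1 / 4)
  have hε : 0 < ε := by positivity
  have hε1 : ε ≤ ε₀ := min_le_left _ _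
  have hε2 : ε ≤ 1 / 4 := min_le_right _ _
  have hslope : ∀ t, t ≠ t₀ → |t - t₀| < ε → 0 < (t - t₀)⁻¹ * (η t).re := fun t ht htε => by
    have := hball (y := t) (by rw [Real.dist_eq]; linarith) ht
    simpa [slope_def_module, hη0] using this
  have hne : ∀ t ∈ Icc (t₀ + ε) (t₀ + 1 - ε), η t ≠ 0 := by
    intro t ht h
    have h1 : γ t = γ t₀ := by
      rcases div_eq_zero_iff.1 h with h | h
      · exact sub_eq_zero.1 h
      · exact absurd h h0
    obtain ⟨n, hn⟩ := hγ.eq_iff.1 h1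
    have h2 : (0 : ℝ) < n := by linarith [ht.1]
    have h3 : (n : ℝ) < 1 := by linarith [ht.2]
    have h2 : 0 < n := by exact_mod_cast h2
    have h3 : n < 1 := by exact_mod_cast h3
    omega
  have hηc : Continuous η := (hγ.continuous.sub continuous_const).div_const _
  obtain ⟨x, hx, hmin⟩ := (isCompact_Icc (a := t₀ + ε) (b := t₀ + 1 - ε)).exists_isMinOn
    (nonempty_Icc.2 (by linarith)) hηc.norm.continuousOn
  have hxpos : 0 < ‖η x‖ := norm_pos_iff.2 (hne x hx)
  refine ⟨ε, hε, ‖η x‖ / 2, by positivity, by linarith, fun t ht => ?_, fun t ht => ?_,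
    fun t ht => ?_⟩
  · have h1 : 0 < t - t₀ := by linarith [ht.1]
    have := hslope t (by linarith) (by rw [abs_of_pos h1]; linarith [ht.2])
    exact (pos_iff_pos_of_mul_pos this).1 (by positivity)
  · have h1 : t - 1 - t₀ < 0 := by linarith [ht.2]
    have h2 := hslope (t - 1) (by linarith) (by rw [abs_of_neg h1]; linarith [ht.1])
    have h3 : η (t - 1) = η t := by
      simp only [hη]
      rw [hγ.periodic.sub_eq]
    rw [h3] at h2
    by_contra hcon
    have := mul_nonpos_of_nonpos_of_nonneg (inv_nonpos.2 h1.le) (not_lt.1 hcon)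
    linarith
  · have := hmin ht
    simp only [mem_ofPred_eq] at this
    show ‖η x‖ / 2 < ‖η t‖
    linarith

/-- Some two points off the loop have winding numbers differing by one. -/
lemma exists_windingNumber_sub_eq_one (hγ : IsPiecewiseSmoothJordanLoop γ) :
    ∃ z z', z ∉ range γ ∧ z' ∉ range γ ∧ windingNumber γ 0 1 z - windingNumber γ 0 1 z' = 1 := by
  obtain ⟨t₀, hd, h0⟩ := hγ.exists_deriv_ne_zero
  obtain ⟨ε, hε, δ, hδ, hε2, hpos, hneg, hfar⟩ := hγ.exists_transversal hd h0
  set v := deriv γ t₀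
  set η : ℝ → ℂ := fun t => (γ t - γ t₀) / v with hη
  have hηc : Continuous η := (hγ.continuous.sub continuous_const).div_const _
  have hγη : ∀ t, γ t = γ t₀ + v * η t := fun t => by
    simp only [hη]
    field_simp
    ring
  have hη0 : η t₀ = 0 := by simp [hη]
  have hη1 : η (t₀ + 1) = 0 := by simp [hη, hγ.periodic t₀]
  have hclear : ∀ t ∈ Ioo t₀ (t₀ + 1), (η t).re = 0 → δ < ‖η t‖ := by
    intro t ht hre
    apply hfar t
    constructor
    · by_contra hcon
      exact (hpos t ⟨ht.1, not_le.1 hcon⟩).ne' hre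
    · by_contra hcon
      exact (hneg t ⟨not_le.1 hcon, ht.2⟩).ne hre
  have hseg : ∀ t ∈ Icc t₀ (t₀ + 1), ∀ d : ℝ, |d| = δ → η t ≠ d * Complex.I := by
    intro t ht d hd h
    have hre : (η t).re = 0 := by simp [h]
    have hnorm : ‖η t‖ = δ := by simp [h, hd]
    have hz : η t ≠ 0 := fun hz => by rw [hz, norm_zero] at hnorm; linarith
    have ht' : t ∈ Ioo t₀ (t₀ + 1) := by
      refine ⟨lt_of_le_of_ne ht.1 ?_, lt_of_le_of_ne ht.2 ?_⟩
      · rintro rfl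
        exact hz hη0
      · rintro rfl
        exact hz hη1
    exact absurd hnorm (hclear t ht' hre).ne'
  have hmem : ∀ d : ℝ, |d| = δ → γ t₀ + v * (d * Complex.I) ∉ γ '' uIcc t₀ (t₀ + 1) := by
    rintro d hd ⟨t, ht, h⟩
    rw [uIcc_of_le (by linarith)] at ht
    rw [hγη t] at h
    exact hseg t ht d hd (mul_left_cancel₀ h0 (add_left_cancel h))
  set zp := γ t₀ + v * (δ * Complex.I) with hzp
  set zm := γ t₀ + v * ((-δ : ℝ) * Complex.I) with hzm
  have hp := hmem δ (abs_of_pos hδ)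
  have hm := hmem (-δ) (by rw [abs_neg, abs_of_pos hδ])
  have hc := hγ.almostC1On t₀ (t₀ + 1)
  have hper : γ t₀ = γ (t₀ + 1) := (hγ.periodic t₀).symm
  refine ⟨zp, zm, by rwa [hγ.range_eq_image t₀], by rwa [hγ.range_eq_image t₀], ?_⟩
  rw [← hγ.windingNumber_shift t₀, ← hγ.windingNumber_shift t₀ zm]
  -- The quotient `q` maps the segment between `δi` and `-δi` to the nonpositive reals and infinity.
  -- Between the two ends of the period `η` misses that segment, so `q` stays in the slit plane and
  -- `log q + πi` is a logarithm of `exp f`.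
  set f : ℝ → ℂ := fun u => (∫ t in t₀..u, deriv γ t / (γ t - zp)) -
    ∫ t in t₀..u, deriv γ t / (γ t - zm) with hf
  set q : ℝ → ℂ := fun u => (η u - δ * Complex.I) / (η u + δ * Complex.I) with hq
  have hfc : ContinuousOn f (uIcc t₀ (t₀ + 1)) :=
    (hc.continuousOn_primitive_logDeriv hp).sub (hc.continuousOn_primitive_logDeriv hm)
  have hI : uIcc t₀ (t₀ + 1) = Icc t₀ (t₀ + 1) := uIcc_of_le (by linarith)
  have hden : ∀ t ∈ Icc t₀ (t₀ + 1), η t + δ * Complex.I ≠ 0 := fun t ht h => by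
    refine hseg t ht (-δ) (by rw [abs_neg, abs_of_pos hδ]) ?_
    push_cast
    linear_combination h
  have hqc : ContinuousOn q (Icc t₀ (t₀ + 1)) :=
    (hηc.continuousOn.sub continuousOn_const).div (hηc.continuousOn.add continuousOn_const) hden
  have hqre : ∀ u, (q u).re = (‖η u‖ ^ 2 - δ ^ 2) / Complex.normSq (η u + δ * Complex.I) := by
    intro u
    simp only [hq, Complex.div_re, ← Complex.normSq_eq_norm_sq, Complex.normSq_apply (η u)]
    simp
    ring
  have hqim : ∀ u, (q u).im = (-2 * δ * (η u).re) / Complex.normSq (η u + δ * Complex.I) := by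
    intro u
    simp only [hq, Complex.div_im]
    simp
    ring
  have hNpos : ∀ t ∈ Icc t₀ (t₀ + 1), 0 < Complex.normSq (η t + δ * Complex.I) :=
    fun t ht => Complex.normSq_pos.2 (hden t ht)
  have hslit : ∀ t ∈ Ioo t₀ (t₀ + 1), q t ∈ Complex.slitPlane := by
    intro t ht
    have hN := hNpos t (Ioo_subset_Icc_self ht)
    rw [Complex.mem_slitPlane_iff]
    by_cases hre : (η t).re = 0
    · left
      rw [hqre]
      have := hclear t ht hre
      have : δ ^ 2 < ‖η t‖ ^ 2 := by gcongr
      exact div_pos (by linarith) hN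
    · right
      rw [hqim]
      exact div_ne_zero (mul_ne_zero (by linarith) hre) hN.ne'
  have hexp : ∀ u ∈ Ioo t₀ (t₀ + 1), Complex.exp (f u) =
      Complex.exp (Complex.log (q u) + Real.pi * Complex.I) := by
    intro u hu
    have huI := Ioo_subset_Icc_self hu
    rw [Complex.exp_sub, hc.exp_primitive_logDeriv hp (hI ▸ huI),
      hc.exp_primitive_logDeriv hm (hI ▸ huI), Complex.exp_add, Complex.exp_pi_mul_I,
      Complex.exp_log (Complex.slitPlane_ne_zero (hslit u hu)), hγη u]
    have h1 : γ t₀ + v * η u - (γ t₀ + v * (δ * Complex.I)) = v * (η u - δ * Complex.I) := by ring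
    have h2 : γ t₀ + v * η u - (γ t₀ + v * ((-δ : ℝ) * Complex.I)) = v * (η u + δ * Complex.I) := by
      push_cast; ring
    have h3 : γ t₀ - (γ t₀ + v * (δ * Complex.I)) = -(v * (δ * Complex.I)) := by ring
    have h4 : γ t₀ - (γ t₀ + v * ((-δ : ℝ) * Complex.I)) = v * (δ * Complex.I) := by
      push_cast; ring
    rw [h1, h2, h3, h4]
    have h5 := hden u huI
    have h6 : (δ : ℂ) ≠ 0 := by exact_mod_cast hδ.ne'
    simp only [hq]
    field_simp
  have hconst : ∀ u ∈ Ioo t₀ (t₀ + 1), f u - Complex.log (q u) =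
      f (t₀ + 1 / 2) - Complex.log (q (t₀ + 1 / 2)) := by
    intro u hu
    have := isPreconnected_Ioo.sub_eq_of_exp_eq
      (hfc.mono (hI ▸ Ioo_subset_Icc_self))
      (((hqc.mono Ioo_subset_Icc_self).clog hslit).add continuousOn_const) hexp hu
      (y := t₀ + 1 / 2) ⟨by linarith, by linarith⟩
    simp only [Pi.add_apply] at this
    linear_combination this
  set C := f (t₀ + 1 / 2) - Complex.log (q (t₀ + 1 / 2))
  have hδc : (δ : ℂ) ≠ 0 := by exact_mod_cast hδ.ne'
  have hq0 : ∀ t, η t = 0 → q t = -1 := fun t ht => by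
    simp only [hq, ht]
    field_simp
    simp
  have hleft : t₀ ∈ Icc t₀ (t₀ + 1) := ⟨le_rfl, by linarith⟩
  have hright : t₀ + 1 ∈ Icc t₀ (t₀ + 1) := ⟨by linarith, le_rfl⟩
  -- At the start `q` tends to `-1` from below, where `log q → -πi`; at the end it does so from
  -- above, where `log q → πi`. Hence `f` gains `2πi` in one turn.
  have hC1 : C = f t₀ + Real.pi * Complex.I := by
    have hlim1 : Filter.Tendsto f (nhdsWithin t₀ (Ioo t₀ (t₀ + 1))) (nhds (f t₀)) :=
      (hfc t₀ (hI ▸ hleft)).mono_left (nhdsWithin_mono _ (hI ▸ Ioo_subset_Icc_self))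
    have hlim2 : Filter.Tendsto q (nhdsWithin t₀ (Ioo t₀ (t₀ + 1)))
        (nhdsWithin (-1) {z : ℂ | z.im < 0}) := by
      refine tendsto_nhdsWithin_iff.2 ⟨?_, ?_⟩
      · rw [← hq0 t₀ hη0]
        exact (hqc t₀ hleft).mono_left (nhdsWithin_mono _ Ioo_subset_Icc_self)
      · have : Ioo t₀ (t₀ + ε) ∈ nhdsWithin t₀ (Ioo t₀ (t₀ + 1)) := by
          rw [nhdsWithin_Ioo_eq_nhdsGT (by linarith)]
          exact Ioo_mem_nhdsGT (by linarith)
        filter_upwards [this] with t ht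
        show (q t).im < 0
        rw [hqim]
        refine div_neg_of_neg_of_pos ?_ (hNpos t ⟨ht.1.le, by linarith [ht.2]⟩)
        have h1 := mul_pos hδ (hpos t ht)
        show -2 * δ * (η t).re < 0
        linarith
    have hlim3 := (Complex.tendsto_log_nhdsWithin_im_neg_of_re_neg_of_im_zero (z := -1)
      (by simp) (by simp)).comp hlim2
    have hne : (nhdsWithin t₀ (Ioo t₀ (t₀ + 1))).NeBot := by
      rw [nhdsWithin_Ioo_eq_nhdsGT (by linarith)]
      infer_instance
    have := tendsto_nhds_unique_of_eventuallyEq (hlim1.sub hlim3) tendsto_const_nhds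
      (b := C) (by filter_upwards [self_mem_nhdsWithin] with t ht using hconst t ht)
    rw [← this]
    simp
  have hC2 : C = f (t₀ + 1) - Real.pi * Complex.I := by
    have hlim1 : Filter.Tendsto f (nhdsWithin (t₀ + 1) (Ioo t₀ (t₀ + 1))) (nhds (f (t₀ + 1))) :=
      (hfc _ (hI ▸ hright)).mono_left (nhdsWithin_mono _ (hI ▸ Ioo_subset_Icc_self))
    have hlim2 : Filter.Tendsto q (nhdsWithin (t₀ + 1) (Ioo t₀ (t₀ + 1)))
        (nhdsWithin (-1) {z : ℂ | 0 ≤ z.im}) := by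
      refine tendsto_nhdsWithin_iff.2 ⟨?_, ?_⟩
      · rw [← hq0 _ hη1]
        exact (hqc _ hright).mono_left (nhdsWithin_mono _ Ioo_subset_Icc_self)
      · have : Ioo (t₀ + 1 - ε) (t₀ + 1) ∈ nhdsWithin (t₀ + 1) (Ioo t₀ (t₀ + 1)) := by
          rw [nhdsWithin_Ioo_eq_nhdsLT (by linarith)]
          exact Ioo_mem_nhdsLT (by linarith)
        filter_upwards [this] with t ht
        show 0 ≤ (q t).im
        rw [hqim]
        refine div_nonneg ?_ (hNpos t ⟨by linarith [ht.1], ht.2.le⟩).le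
        have h1 := mul_neg_of_pos_of_neg hδ (hneg t ht)
        show 0 ≤ -2 * δ * (η t).re
        linarith
    have hlim3 := (Complex.tendsto_log_nhdsWithin_im_nonneg_of_re_neg_of_im_zero (z := -1)
      (by simp) (by simp)).comp hlim2
    have hne : (nhdsWithin (t₀ + 1) (Ioo t₀ (t₀ + 1))).NeBot := by
      rw [nhdsWithin_Ioo_eq_nhdsLT (by linarith)]
      infer_instance
    have := tendsto_nhds_unique_of_eventuallyEq (hlim1.sub hlim3) tendsto_const_nhds
      (b := C) (by filter_upwards [self_mem_nhdsWithin] with t ht using hconst t ht)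
    rw [← this]
    simp
  have hf0 : f t₀ = 0 := by simp [hf]
  have hf1 : f (t₀ + 1) = (windingNumber γ t₀ (t₀ + 1) zp - windingNumber γ t₀ (t₀ + 1) zm) *
      (2 * Real.pi * Complex.I) := by
    simp only [hf]
    rw [hc.integral_logDeriv_eq_windingNumber hper hp,
      hc.integral_logDeriv_eq_windingNumber hper hm]
    ring
  have hfin : ((windingNumber γ t₀ (t₀ + 1) zp - windingNumber γ t₀ (t₀ + 1) zm : ℝ) : ℂ) *
      (2 * Real.pi * Complex.I) = 1 * (2 * Real.pi * Complex.I) := by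
    push_cast
    rw [hf0] at hC1
    linear_combination hC1 - hC2 - hf1
  exact_mod_cast mul_right_cancel₀ Complex.two_pi_I_ne_zero hfin

/-- Off the loop only this value and `0` occur, and two of the values that occur differ by one. -/
lemma abs_windingNumber_eq_one (hγ : IsPiecewiseSmoothJordanLoop γ) {z : ℂ}
    (hz : z ∈ boundedRegion (range γ)) : |windingNumber γ 0 1 z| = 1 := by
  have hval : ∀ w ∉ range γ, windingNumber γ 0 1 w = windingNumber γ 0 1 z ∨
      windingNumber γ 0 1 w = 0 := fun w hw => by
    by_cases h : w ∈ boundedRegion (range γ)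
    · exact Or.inl (hγ.windingNumber_eq_of_mem hz h)
    · exact Or.inr (hγ.windingNumber_eq_zero hw h)
  obtain ⟨w, w', hw, hw', h⟩ := hγ.exists_windingNumber_sub_eq_one
  rcases hval w hw with h1 | h1 <;> rcases hval w' hw' with h2 | h2 <;> rw [h1, h2] at h
  · simp at h
  · rw [sub_zero] at h; simp [h]
  · rw [zero_sub] at h; rw [← abs_neg, h, abs_one]
  · simp at h

lemma isOpen_boundedRegion (hγ : IsPiecewiseSmoothJordanLoop γ) :
    IsOpen (boundedRegion (range γ)) := by
  rw [isOpen_iff_forall_mem_open]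
  refine fun z hz => ⟨connectedComponentIn (range γ)ᶜ z, fun w hw => ?_,
    hγ.isCompact_range.isClosed.isOpen_compl.connectedComponentIn, mem_connectedComponentIn hz.1⟩
  exact ⟨connectedComponentIn_subset _ _ hw, by rw [← connectedComponentIn_eq hw]; exact hz.2⟩

lemma volume_boundedRegion_ne_top (hγ : IsPiecewiseSmoothJordanLoop γ) :
    volume (boundedRegion (range γ)) ≠ ⊤ := by
  obtain ⟨R, hR⟩ := (hγ.almostC1On 0 1).exists_norm_lt
  refine (measure_mono_top (s₂ := Metric.ball (0 : ℂ) R) (fun z hz => ?_)).mt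
    measure_ball_lt_top.ne
  by_contra hout
  exact hγ.windingNumber_ne_zero hz
    ((hγ.almostC1On 0 1).windingNumber_eq_zero hγ.apply_zero hR hout)

/-- The signed area bounded by a Jordan loop is, up to sign, the area of its bounded region. -/
lemma ofReal_abs_integral_windingNumber (hγ : IsPiecewiseSmoothJordanLoop γ) :
    ENNReal.ofReal |∫ z, windingNumber γ 0 1 z| = volume (boundedRegion (range γ)) := by
  obtain ⟨n, hn, hw⟩ : ∃ n : ℝ, |n| = 1 ∧
      ∀ z ∉ range γ, windingNumber γ 0 1 z = (boundedRegion (range γ)).indicator (fun _ => n) z := by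
    by_cases hne : (boundedRegion (range γ)).Nonempty
    · obtain ⟨z₀, hz₀⟩ := hne
      refine ⟨windingNumber γ 0 1 z₀, hγ.abs_windingNumber_eq_one hz₀, fun z hz => ?_⟩
      by_cases h : z ∈ boundedRegion (range γ)
      · rw [indicator_of_mem h, hγ.windingNumber_eq_of_mem hz₀ h]
      · rw [indicator_of_notMem h, hγ.windingNumber_eq_zero hz h]
    -- With an empty bounded region the constant is immaterial.
    · refine ⟨1, abs_one, fun z hz => ?_⟩
      have h : z ∉ boundedRegion (range γ) := fun h => hne ⟨z, h⟩
      rw [indicator_of_notMem h, hγ.windingNumber_eq_zero hz h]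
  have hae : windingNumber γ 0 1 =ᵐ[volume] (boundedRegion (range γ)).indicator fun _ => n := by
    have := (hγ.almostC1On 0 1).ae_notMem_image
    rw [hγ.image_uIcc] at this
    filter_upwards [this] with z hz using hw z hz
  rw [integral_congr_ae hae, integral_indicator_const n hγ.isOpen_boundedRegion.measurableSet,
    smul_eq_mul, abs_mul, hn, mul_one, abs_of_nonneg measureReal_nonneg,
    ofReal_measureReal hγ.volume_boundedRegion_ne_top]

end IsPiecewiseSmoothJordanLoop

/-! ### The area form along curves -/

/-- The integral of `x dy - y dx` along the curve `c`, twice the area swept out from the origin. -/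
noncomputable def areaIntegral (c : ℝ → ℂ) (a b : ℝ) : ℝ :=
  ∫ t in a..b, (deriv c t * starRingEnd ℂ (c t)).im

lemma deriv_eq_of_eqOn_Ioo {c c' : ℝ → ℂ} {a b : ℝ} (h : EqOn c c' (Ioo a b)) {t : ℝ}
    (ht : t ∈ Ioo a b) : deriv c t = deriv c' t :=
  Filter.EventuallyEq.deriv_eq (h.eventuallyEq_of_mem (Ioo_mem_nhds ht.1 ht.2))

lemma areaIntegral_congr {c c' : ℝ → ℂ} {a b : ℝ} (hab : a ≤ b) (h : EqOn c c' (Icc a b)) :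
    areaIntegral c a b = areaIntegral c' a b := by
  refine intervalIntegral.integral_congr_ae ?_
  filter_upwards [Ioo_min_max_ae (a := a) (b := b) countable_empty] with t ht ht'
  have h1 := (ht ht').1
  rw [min_eq_left hab, max_eq_right hab] at h1
  rw [deriv_eq_of_eqOn_Ioo (h.mono Ioo_subset_Icc_self) h1, h (Ioo_subset_Icc_self h1)]

namespace AlmostC1On
variable {c c' : ℝ → ℂ} {a b d : ℝ}

lemma congr (h : AlmostC1On c a b) (hab : a ≤ b) (hc : EqOn c' c (Icc a b)) :
    AlmostC1On c' a b := by
  obtain ⟨h1, s, hs, M, hM0, hM⟩ := h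
  refine ⟨?_, s, hs, M, hM0, fun t ht => ?_⟩
  · rw [uIcc_of_le hab] at *
    exact h1.congr hc
  · have ht' := ht.1
    rw [min_eq_left hab, max_eq_right hab] at ht'
    rw [deriv_eq_of_eqOn_Ioo (hc.mono Ioo_subset_Icc_self) ht']
    exact ⟨(hM t ht).1.congr_of_eventuallyEq
      (hc.eventuallyEq_of_mem (Icc_mem_nhds ht'.1 ht'.2)), (hM t ht).2⟩

lemma trans (h : AlmostC1On c a b) (h' : AlmostC1On c b d) (hab : a ≤ b) (hbd : b ≤ d) :
    AlmostC1On c a d := by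
  obtain ⟨h1, s, hs, M, hM0, hM⟩ := h
  obtain ⟨h1', s', hs', M', hM0', hM'⟩ := h'
  rw [uIcc_of_le hab] at h1
  rw [uIcc_of_le hbd] at h1'
  refine ⟨?_, s ∪ s' ∪ {b}, (hs.union hs').union (countable_singleton b), max M M',
    le_max_of_le_left hM0, fun t ht => ?_⟩
  · rw [uIcc_of_le (hab.trans hbd), ← Icc_union_Icc_eq_Icc hab hbd]
    exact h1.union_of_isClosed h1' isClosed_Icc isClosed_Icc
  · rw [min_eq_left hab, max_eq_right hab] at hM
    rw [min_eq_left hbd, max_eq_right hbd] at hM'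
    rw [min_eq_left (hab.trans hbd), max_eq_right (hab.trans hbd)] at ht
    simp only [mem_sdiff, mem_union, mem_singleton_iff, not_or] at ht
    rcases lt_or_gt_of_ne ht.2.2 with hlt | hgt
    · obtain ⟨h2, h3⟩ := hM t ⟨⟨ht.1.1, hlt⟩, ht.2.1.1⟩
      exact ⟨h2, h3.trans (le_max_left _ _)⟩
    · obtain ⟨h2, h3⟩ := hM' t ⟨⟨hgt, ht.1.2⟩, ht.2.1.2⟩
      exact ⟨h2, h3.trans (le_max_right _ _)⟩

lemma intervalIntegrable_area (h : AlmostC1On c a b) :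
    IntervalIntegrable (fun t => (deriv c t * starRingEnd ℂ (c t)).im) volume a b := by
  have h1 := h.intervalIntegrable_deriv_mul
    (Complex.continuous_conj.comp_continuousOn h.continuousOn)
  rw [intervalIntegrable_iff] at h1 ⊢
  exact h1.im

lemma im_integral_eq (h : AlmostC1On c a b) :
    (∫ t in a..b, deriv c t * starRingEnd ℂ (c t)).im = areaIntegral c a b :=
  (Complex.imCLM.intervalIntegral_comp_comm (h.intervalIntegrable_deriv_mul
    (Complex.continuous_conj.comp_continuousOn h.continuousOn))).symm

lemma areaIntegral_add (h : AlmostC1On c a b) (h' : AlmostC1On c b d) :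
    areaIntegral c a b + areaIntegral c b d = areaIntegral c a d :=
  intervalIntegral.integral_add_adjacent_intervals h.intervalIntegrable_area
    h'.intervalIntegrable_area

lemma boundsSignedArea_areaIntegral (h : AlmostC1On c a b) (hab : c a = c b) :
    BoundsSignedArea c a b (areaIntegral c a b / 2) :=
  h.im_integral_eq ▸ h.boundsSignedArea hab

lemma areaIntegral_comp (h : AlmostC1On c a b) {g : ℝ → ℂ}
    (hg : ∀ u v, AlmostC1On g u v) {s : ℝ → ℝ} (hs : ContinuousOn s (uIcc a b))
    (hcs : ∀ t ∈ uIcc a b, c t = g (s t)) :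
    areaIntegral c a b = areaIntegral g (s a) (s b) := by
  rw [← h.im_integral_eq, ← (hg _ _).im_integral_eq, h.integral_deriv_mul_conj_comp hg hs hcs]

end AlmostC1On

lemma hasDerivAt_lineMap_sub (u v : ℂ) (k t : ℝ) :
    HasDerivAt (fun t : ℝ => AffineMap.lineMap u v (t - k)) (v - u) t := by
  simpa using (AffineMap.hasDerivAt_lineMap (a := u) (b := v) (x := t - k)).comp_sub_const t k

lemma almostC1On_lineMap (u v : ℂ) (k a b : ℝ) :
    AlmostC1On (fun t : ℝ => AffineMap.lineMap u v (t - k)) a b := by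
  have hc : ContDiff ℝ 1 (fun t : ℝ => AffineMap.lineMap u v (t - k)) := by
    simp only [AffineMap.lineMap_apply_module']
    fun_prop
  refine ⟨hc.continuous.continuousOn, ∅, countable_empty, ‖v - u‖, norm_nonneg _, fun t _ =>
    ⟨hc.contDiffAt, (hasDerivAt_lineMap_sub u v k t).deriv ▸ le_rfl⟩⟩

/-- The condition on `u` and `v` says that they are on one line through the origin, along which no
area is swept. -/
lemma areaIntegral_lineMap {u v : ℂ} (huv : (v * starRingEnd ℂ u).im = 0) (k a b : ℝ) :
    areaIntegral (fun t : ℝ => AffineMap.lineMap u v (t - k)) a b = 0 := by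
  have : ∀ t : ℝ, (deriv (fun t : ℝ => AffineMap.lineMap u v (t - k)) t *
      starRingEnd ℂ (AffineMap.lineMap u v (t - k))).im = 0 := fun t => by
    rw [(hasDerivAt_lineMap_sub u v k t).deriv, AffineMap.lineMap_apply_module']
    simp at huv ⊢
    linear_combination huv
  simp only [areaIntegral, this, intervalIntegral.integral_zero]

namespace IsPiecewiseSmoothJordanLoop
variable {γ : ℝ → ℂ}

lemma ofReal_abs_areaIntegral (hγ : IsPiecewiseSmoothJordanLoop γ) :
    ENNReal.ofReal |areaIntegral γ 0 1 / 2| = volume (boundedRegion (range γ)) := by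
  rw [← ((hγ.almostC1On 0 1).boundsSignedArea_areaIntegral hγ.apply_zero).2,
    hγ.ofReal_abs_integral_windingNumber]

lemma areaIntegral_add_int (hγ : IsPiecewiseSmoothJordanLoop γ) (x : ℝ) (n : ℤ) :
    areaIntegral γ 0 (x + n) = areaIntegral γ 0 x + n * areaIntegral γ 0 1 := by
  have hd : Function.Periodic (deriv γ) 1 := fun t => by
    rw [← deriv_comp_add_const, hγ.periodic.funext]
  have hp : Function.Periodic (fun t => (deriv γ t * starRingEnd ℂ (γ t)).im) 1 := fun t => by
    simp only [hd t, hγ.periodic t]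
  rw [← (hγ.almostC1On 0 x).areaIntegral_add (hγ.almostC1On x (x + n))]
  have h1 := hp.intervalIntegral_add_zsmul_eq n x
    (fun u v => (hγ.almostC1On u v).intervalIntegrable_area)
  rw [hp.intervalIntegral_add_eq x 0] at h1
  simp only [zsmul_eq_mul, mul_one, zero_add] at h1
  rw [areaIntegral, areaIntegral, h1, ← areaIntegral, ← areaIntegral]

end IsPiecewiseSmoothJordanLoop

/-! ### The area swept by the shape curve in terms of the vertices -/

lemma HasDerivAt.norm_of_ne_zero {a : ℝ → ℂ} {a' : ℂ} {t : ℝ} (h : HasDerivAt a a' t)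
    (h0 : a t ≠ 0) : HasDerivAt (fun u => ‖a u‖) ((starRingEnd ℂ (a t) * a').re / ‖a t‖) t := by
  have h1 := h.norm_sq.sqrt (by simpa using h0)
  simp only [Real.sqrt_sq (norm_nonneg _)] at h1
  convert h1 using 1
  rw [Complex.inner, mul_div_mul_left _ _ two_ne_zero]
  ring_nf

/-- For perpendicular vectors `a`, `b` of lengths `X`, `Y`, the form `X dY - Y dX` is, up to the
orientation `ε` of the pair, the sum of the two mixed area forms of `a` and `b`. -/
lemma mul_sub_mul_eq_of_perpendicular {a b a' b' : ℂ} {X Y ε : ℝ} (hX : X ≠ 0) (hY : Y ≠ 0)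
    (hXa : X ^ 2 = Complex.normSq a) (hperp : (starRingEnd ℂ a * b).re = 0)
    (hε : ε ^ 2 = 1) (hor : (starRingEnd ℂ a * b).im = ε * (X * Y)) :
    X * ((starRingEnd ℂ b * b').re / Y) - Y * ((starRingEnd ℂ a * a').re / X) =
      ε * ((starRingEnd ℂ a * b').im + (starRingEnd ℂ b * a').im) := by
  rw [Complex.normSq_apply] at hXa
  simp only [Complex.mul_re, Complex.mul_im, Complex.conj_re, Complex.conj_im] at *
  -- `h1` and `h2` together are the complex equation `X b = ε i Y a`.
  have h1 : X * b.re = -ε * Y * a.im := by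
    apply mul_left_cancel₀ hX
    linear_combination b.re * hXa + a.re * hperp - a.im * hor
  have h2 : X * b.im = ε * Y * a.re := by
    apply mul_left_cancel₀ hX
    linear_combination b.im * hXa + a.im * hperp + a.re * hor
  field_simp
  linear_combination (X * b'.re - ε * a'.im * Y) * h1 + (X * b'.im + ε * a'.re * Y) * h2 +
    Y ^ 2 * (a'.im * a.im + a'.re * a.re) * hε

lemma PiecewiseSmoothOn.apply_almostC1On {α : ℝ → Fin 4 → ℂ} (h : PiecewiseSmoothOn α 0 1)
    (j : Fin 4) : AlmostC1On (fun t => α t j) 0 1 := by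
  obtain ⟨s, hs, M, hM0, hM⟩ := h.exists_countable
  refine ⟨?_, s, hs, M, hM0, fun t ht => ?_⟩
  · rw [uIcc_of_le zero_le_one]
    exact (continuous_apply j).comp_continuousOn h.1
  · rw [min_eq_left zero_le_one, max_eq_right zero_le_one] at ht
    obtain ⟨h1, h2⟩ := hM t ht
    refine ⟨contDiffAt_pi.1 h1 j, ?_⟩
    have h3 := hasDerivAt_pi.1 ((h1.differentiableAt one_ne_zero).hasDerivAt) j
    rw [h3.deriv]
    exact (norm_le_pi_norm _ j).trans h2

lemma shape_eq (R : Fin 4 → ℂ) :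
    shape R = (‖R 1 - R 0‖ : ℂ) + (‖R 2 - R 1‖ : ℂ) * Complex.I := by
  apply Complex.ext <;> simp [shape, dist_eq_norm, norm_sub_rev]

namespace IsGracingPath
variable {γ : ℝ → ℂ} {α : ℝ → Fin 4 → ℂ}

lemma sub_ne_zero₁ (hα : IsGracingPath γ α) {t : ℝ} (ht : t ∈ Ioo (0 : ℝ) 1) :
    α t 1 - α t 0 ≠ 0 := sub_ne_zero.2 (hα.graces t ht).1.first_ne.symm

lemma sub_ne_zero₂ (hα : IsGracingPath γ α) {t : ℝ} (ht : t ∈ Ioo (0 : ℝ) 1) :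
    α t 2 - α t 1 ≠ 0 := sub_ne_zero.2 (hα.graces t ht).1.second_ne.symm

lemma almostC1On_apply (hα : IsGracingPath γ α) (j : Fin 4) : AlmostC1On (fun t => α t j) 0 1 :=
  hα.piecewiseSmooth.apply_almostC1On j

lemma hasDerivAt_shapeCurve (hα : IsGracingPath γ α) {t : ℝ} (ht : t ∈ Ioo (0 : ℝ) 1)
    (hd : ∀ j, HasDerivAt (fun t => α t j) (deriv (fun t => α t j) t) t) :
    HasDerivAt (shapeCurve α)
      (((starRingEnd ℂ (α t 1 - α t 0) *
          (deriv (fun t => α t 1) t - deriv (fun t => α t 0) t)).re / ‖α t 1 - α t 0‖ : ℝ) +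
        ((starRingEnd ℂ (α t 2 - α t 1) *
          (deriv (fun t => α t 2) t - deriv (fun t => α t 1) t)).re / ‖α t 2 - α t 1‖ : ℝ) *
          Complex.I) t := by
  have hX := ((hd 1).sub (hd 0)).norm_of_ne_zero (hα.sub_ne_zero₁ ht)
  have hY := ((hd 2).sub (hd 1)).norm_of_ne_zero (hα.sub_ne_zero₂ ht)
  have h := hX.ofReal_comp.add (hY.ofReal_comp.mul_const Complex.I)
  have hs : shapeCurve α = fun t => shape (α t) := rfl
  rw [hs]
  simp only [shape_eq]
  exact h

/-- On the open interval the sides do not vanish, so their lengths are as smooth as the vertices. At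
the possibly degenerate ends only continuity is needed. -/
lemma almostC1On_shapeCurve (hα : IsGracingPath γ α) : AlmostC1On (shapeCurve α) 0 1 := by
  obtain ⟨s, hs, M, hM0, hM⟩ := hα.piecewiseSmooth.exists_countable
  have hs' : shapeCurve α = fun t => (‖α t 1 - α t 0‖ : ℂ) + (‖α t 2 - α t 1‖ : ℂ) * Complex.I :=
    funext fun t => shape_eq (α t)
  have hbound : ∀ a a' : ℂ, |(starRingEnd ℂ a * a').re / ‖a‖| ≤ ‖a'‖ := fun a a' => by
    rw [abs_div, abs_norm]
    refine div_le_of_le_mul₀ (norm_nonneg _) (norm_nonneg _) ?_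
    refine (Complex.abs_re_le_norm _).trans ?_
    rw [norm_mul, Complex.norm_conj, mul_comm]
  -- Each side length changes at speed at most `2 * M`.
  refine ⟨?_, s, hs, 4 * M, by positivity, fun t ht => ?_⟩
  · have hc := fun j => (hα.almostC1On_apply j).continuousOn
    rw [hs']
    have h0 := hc 0
    have h1 := hc 1
    have h2 := hc 2
    fun_prop
  · rw [min_eq_left zero_le_one, max_eq_right zero_le_one] at ht
    obtain ⟨h1, h2⟩ := hM t ht
    have hcd := fun j => contDiffAt_pi.1 h1 j
    have hd := fun j => (hcd j).hasDerivAt_one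
    have hdle : ∀ j, ‖deriv (fun t => α t j) t‖ ≤ M := fun j => by
      rw [(hasDerivAt_pi.1 ((h1.differentiableAt one_ne_zero).hasDerivAt) j).deriv]
      exact (norm_le_pi_norm _ j).trans h2
    constructor
    · rw [hs']
      have hX := ((hcd 1).sub (hcd 0)).norm ℝ (hα.sub_ne_zero₁ ht.1)
      have hY := ((hcd 2).sub (hcd 1)).norm ℝ (hα.sub_ne_zero₂ ht.1)
      exact ((Complex.ofRealCLM.contDiff.contDiffAt.comp t hX).add
        ((Complex.ofRealCLM.contDiff.contDiffAt.comp t hY).mul contDiffAt_const))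
    · rw [(hα.hasDerivAt_shapeCurve ht.1 hd).deriv]
      refine (norm_add_le _ _).trans ?_
      rw [norm_mul, Complex.norm_I, mul_one, Complex.norm_real, Complex.norm_real,
        Real.norm_eq_abs, Real.norm_eq_abs]
      have h3 := (hbound (α t 1 - α t 0)
        (deriv (fun t => α t 1) t - deriv (fun t => α t 0) t)).trans (norm_sub_le _ _)
      have h4 := (hbound (α t 2 - α t 1)
        (deriv (fun t => α t 2) t - deriv (fun t => α t 1) t)).trans (norm_sub_le _ _)
      have := hdle 0
      have := hdle 1
      have := hdle 2
      linarith

/-- The rectangles of a gracing path all have the same orientation. -/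
lemma exists_orientation (hα : IsGracingPath γ α) : ∃ ε : ℝ, ε ^ 2 = 1 ∧ ∀ t ∈ Ioo (0 : ℝ) 1,
    (starRingEnd ℂ (α t 1 - α t 0) * (α t 2 - α t 1)).re = 0 ∧
    (starRingEnd ℂ (α t 1 - α t 0) * (α t 2 - α t 1)).im =
      ε * (‖α t 1 - α t 0‖ * ‖α t 2 - α t 1‖) := by
  have hre : ∀ t ∈ Ioo (0 : ℝ) 1,
      (starRingEnd ℂ (α t 1 - α t 0) * (α t 2 - α t 1)).re = 0 := fun t ht => by
    have := (hα.graces t ht).1.perpendicular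
    rwa [Complex.inner, mul_comm] at this
  have hne : ∀ t ∈ Ioo (0 : ℝ) 1, ‖α t 1 - α t 0‖ * ‖α t 2 - α t 1‖ ≠ 0 := fun t ht =>
    mul_ne_zero (norm_ne_zero_iff.2 (hα.sub_ne_zero₁ ht)) (norm_ne_zero_iff.2 (hα.sub_ne_zero₂ ht))
  -- `σ` is the sine of the angle from the first side to the second: `±1` for perpendicular sides,
  -- and continuous, hence constant.
  set σ : ℝ → ℝ := fun t => (starRingEnd ℂ (α t 1 - α t 0) * (α t 2 - α t 1)).im /
    (‖α t 1 - α t 0‖ * ‖α t 2 - α t 1‖) with hσ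
  have hsq : ∀ t ∈ Ioo (0 : ℝ) 1, σ t ^ 2 = 1 := fun t ht => by
    have h1 := Complex.sq_norm (starRingEnd ℂ (α t 1 - α t 0) * (α t 2 - α t 1))
    rw [Complex.normSq_apply, hre t ht, norm_mul, Complex.norm_conj] at h1
    simp only [hσ]
    rw [div_pow, h1, div_eq_one_iff_eq]
    · ring
    · rw [← h1]
      exact pow_ne_zero 2 (hne t ht)
  have hc : ContinuousOn σ (Ioo 0 1) := by
    have hcj := fun j => (hα.almostC1On_apply j).continuousOn.mono
      (Ioo_subset_Icc_self.trans (uIcc_of_le (zero_le_one (α := ℝ))).ge)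
    have h0 := hcj 0
    have h1 := hcj 1
    have h2 := hcj 2
    refine ContinuousOn.div ?_ (by fun_prop) hne
    refine Complex.continuous_im.comp_continuousOn (ContinuousOn.mul ?_ (by fun_prop))
    exact Complex.continuous_conj.comp_continuousOn (by fun_prop)
  have hhalf : (1 / 2 : ℝ) ∈ Ioo (0 : ℝ) 1 := by norm_num
  refine ⟨σ (1 / 2), hsq _ hhalf, fun t ht => ⟨hre t ht, ?_⟩⟩
  rw [isPreconnected_Ioo.eq_of_forall_exists_int hc (fun t ht => ?_) hhalf ht]
  · exact (div_mul_cancel₀ _ (hne t ht)).symm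
  · rcases sq_eq_one_iff.1 (hsq t ht) with h | h
    · exact ⟨1, by simp [h]⟩
    · exact ⟨-1, by simp [h]⟩

/-- The area swept by the shape curve is, up to sign, the alternating sum of the areas swept by
the vertices. -/
lemma exists_areaIntegral_shapeCurve (hα : IsGracingPath γ α) : ∃ ε : ℝ, ε ^ 2 = 1 ∧
    areaIntegral (shapeCurve α) 0 1 =
      ε * (areaIntegral (fun t => α t 0) 0 1 - areaIntegral (fun t => α t 1) 0 1 +
        areaIntegral (fun t => α t 2) 0 1 - areaIntegral (fun t => α t 3) 0 1) := by
  obtain ⟨ε, hε, hor⟩ := hα.exists_orientation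
  refine ⟨ε, hε, ?_⟩
  obtain ⟨s, hs, M, hM0, hM⟩ := hα.piecewiseSmooth.exists_countable
  have hi := fun j => (hα.almostC1On_apply j).intervalIntegrable_area
  simp only [areaIntegral]
  rw [← intervalIntegral.integral_sub (hi 0) (hi 1),
    ← intervalIntegral.integral_add ((hi 0).sub (hi 1)) (hi 2),
    ← intervalIntegral.integral_sub (((hi 0).sub (hi 1)).add (hi 2)) (hi 3),
    ← intervalIntegral.integral_const_mul]
  refine intervalIntegral.integral_congr_ae ?_
  filter_upwards [Ioo_min_max_ae (a := 0) (b := 1) hs] with t ht ht'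
  have ht := ht ht'
  rw [min_eq_left zero_le_one, max_eq_right zero_le_one] at ht
  have hd := fun j => (contDiffAt_pi.1 (hM t ht).1 j).hasDerivAt_one
  -- Once the last vertex is eliminated, the alternating sum of the quadratic area forms leaves only
  -- the terms mixing the two sides.
  have hpar : ∀ u ∈ Ioo (0 : ℝ) 1, α u 3 = α u 0 + α u 2 - α u 1 := fun u hu => by
    linear_combination (hα.graces u hu).1.parallelogram
  have hd3 : deriv (fun t => α t 3) t = deriv (fun t => α t 0) t + deriv (fun t => α t 2) t -
      deriv (fun t => α t 1) t := by
    rw [deriv_eq_of_eqOn_Ioo (c' := fun u => α u 0 + α u 2 - α u 1) hpar ht.1]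
    exact (((hd 0).add (hd 2)).sub (hd 1)).deriv
  obtain ⟨hre, him⟩ := hor t ht.1
  have key := mul_sub_mul_eq_of_perpendicular
    (a' := deriv (fun t => α t 1) t - deriv (fun t => α t 0) t)
    (b' := deriv (fun t => α t 2) t - deriv (fun t => α t 1) t)
    (norm_ne_zero_iff.2 (hα.sub_ne_zero₁ ht.1)) (norm_ne_zero_iff.2 (hα.sub_ne_zero₂ ht.1))
    (Complex.sq_norm _) hre hε him
  rw [(hα.hasDerivAt_shapeCurve ht.1 hd).deriv, shapeCurve, shape_eq, hd3, hpar t ht.1]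
  refine Eq.trans ?_ (key.trans ?_)
  · simp
    ring
  · congr 1
    simp
    ring

end IsGracingPath

/-! ### Parameters of the vertices and the alternating area at the ends -/

lemma nonneg_of_ne_zero_on_Ioo {f : ℝ → ℝ} (hf : Continuous f) {x₀ : ℝ} (hx₀ : x₀ ∈ Ioo (0 : ℝ) 1)
    (hpos : 0 < f x₀) (hne : ∀ t ∈ Ioo (0 : ℝ) 1, f t ≠ 0) : ∀ t ∈ Icc (0 : ℝ) 1, 0 ≤ f t := by
  have h : MapsTo f (Ioo 0 1) (Ici 0) := by
    intro t ht
    by_contra hlt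
    obtain ⟨u, hu, hu0⟩ := isPreconnected_Ioo.intermediate_value ht hx₀ hf.continuousOn
      ⟨(not_le.1 hlt).le, hpos.le⟩
    exact hne u hu hu0
  have h2 := h.closure hf
  rwa [closure_Ioo zero_ne_one, isClosed_Ici.closure_eq] at h2

namespace IsGracingPath
variable {γ : ℝ → ℂ} {α : ℝ → Fin 4 → ℂ}

lemma continuousOn_apply (hα : IsGracingPath γ α) (j : Fin 4) :
    ContinuousOn (fun t => α t j) (Icc 0 1) := by
  have := (hα.almostC1On_apply j).continuousOn
  rwa [uIcc_of_le zero_le_one] at this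

lemma apply_mem_range (hα : IsGracingPath γ α) (hγ : IsPiecewiseSmoothJordanLoop γ) (j : Fin 4) :
    ∀ t ∈ Icc (0 : ℝ) 1, α t j ∈ range γ := by
  have h : MapsTo (fun t => α t j) (Ioo 0 1) (range γ) := fun t ht => by
    obtain ⟨s, -, -, hs⟩ := (hα.graces t ht).2
    exact ⟨s j, hs j⟩
  have h2 := h.closure_of_continuousOn (by
    rw [closure_Ioo zero_ne_one]
    exact hα.continuousOn_apply j)
  rwa [closure_Ioo zero_ne_one, hγ.isCompact_range.isClosed.closure_eq] at h2

lemma parallelogram (hα : IsGracingPath γ α) :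
    ∀ t ∈ Icc (0 : ℝ) 1, α t 1 - α t 0 = α t 2 - α t 3 := by
  have h : MapsTo (fun t => (α t 1 - α t 0) - (α t 2 - α t 3)) (Ioo 0 1) {0} := fun t ht =>
    sub_eq_zero.2 (hα.graces t ht).1.parallelogram
  have hc := hα.continuousOn_apply
  have h2 := h.closure_of_continuousOn (by
    rw [closure_Ioo zero_ne_one]
    exact ((hc 1).sub (hc 0)).sub ((hc 2).sub (hc 3)))
  rw [closure_Ioo zero_ne_one, isClosed_singleton.closure_eq] at h2
  exact fun t ht => sub_eq_zero.1 (h2 ht)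

/-- Along a gracing path the vertices move with continuous parameters on the loop, which keep
their cyclic order. -/
lemma exists_parameters (hα : IsGracingPath γ α) (hγ : IsPiecewiseSmoothJordanLoop γ) :
    ∃ s : Fin 4 → ℝ → ℝ, (∀ j, Continuous (s j)) ∧
      (∀ j, ∀ t ∈ Icc (0 : ℝ) 1, γ (s j t) = α t j) ∧
      ∀ t ∈ Icc (0 : ℝ) 1, s 0 t ≤ s 1 t ∧ s 1 t ≤ s 2 t ∧ s 2 t ≤ s 3 t ∧ s 3 t ≤ s 0 t + 1 := by
  have hhalf : (1 / 2 : ℝ) ∈ Ioo (0 : ℝ) 1 := by norm_num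
  obtain ⟨σ, hσ, hσ', hσγ⟩ := (hα.graces _ hhalf).2
  choose s hsc hsσ hs using fun j => hγ.exists_continuous_lift (hα.continuousOn_apply j)
    (hα.apply_mem_range hγ j) (Ioo_subset_Icc_self hhalf) (hσγ j)
  refine ⟨s, hsc, hs, ?_⟩
  have hlt : ∀ i j, i < j → s i (1 / 2) < s j (1 / 2) := fun i j h => by
    rw [hsσ, hsσ]; exact hσ h
  -- Cyclically adjacent vertices are distinct on the open interval, so none of the gaps `s 1 - s
  -- 0`, `s 2 - s 1`, `s 3 - s 2`, `s 0 + 1 - s 3` vanishes there. They keep their sign from `t = 1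
  -- / 2`, and weakly so at the ends.
  have hne : ∀ t ∈ Ioo (0 : ℝ) 1, ∀ i j, α t i ≠ α t j → ∀ n : ℤ, s i t ≠ s j t + n :=
    fun t ht i j h n hn => h (by
      rw [← hs i t (Ioo_subset_Icc_self ht), ← hs j t (Ioo_subset_Icc_self ht)]
      exact hγ.eq_iff.2 ⟨n, hn⟩)
  have hstep : ∀ i j, i < j → (∀ t ∈ Ioo (0 : ℝ) 1, α t i ≠ α t j) →
      ∀ t ∈ Icc (0 : ℝ) 1, s i t ≤ s j t := fun i j hij hd t ht => by
    refine sub_nonneg.1 (nonneg_of_ne_zero_on_Ioo ((hsc j).sub (hsc i)) hhalf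
      (sub_pos.2 (hlt i j hij)) (fun u hu h => hne u hu i j (hd u hu) 0 ?_) t ht)
    simp only [Pi.sub_apply] at h
    rw [Int.cast_zero]
    linarith
  have h01 : ∀ t ∈ Ioo (0 : ℝ) 1, α t 0 ≠ α t 1 := fun t ht => (hα.graces t ht).1.first_ne
  have h12 : ∀ t ∈ Ioo (0 : ℝ) 1, α t 1 ≠ α t 2 := fun t ht => (hα.graces t ht).1.second_ne
  have h23 : ∀ t ∈ Ioo (0 : ℝ) 1, α t 2 ≠ α t 3 := fun t ht h => h01 t ht (by
    have := (hα.graces t ht).1.parallelogram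
    linear_combination -this - h)
  have h30 : ∀ t ∈ Ioo (0 : ℝ) 1, α t 3 ≠ α t 0 := fun t ht h => h12 t ht (by
    have := (hα.graces t ht).1.parallelogram
    linear_combination this - h)
  refine fun t ht => ⟨hstep 0 1 (by decide) h01 t ht, hstep 1 2 (by decide) h12 t ht,
    hstep 2 3 (by decide) h23 t ht, ?_⟩
  have h := nonneg_of_ne_zero_on_Ioo (((hsc 0).add continuous_const).sub (hsc 3)) hhalf
    (f := fun t => s 0 t + 1 - s 3 t) (by
      rw [hsσ, hsσ]; linarith) (fun u hu h => hne u hu 3 0 (h30 u hu) 1 (by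
      rw [Int.cast_one]; linarith)) t ht
  linarith

end IsGracingPath

/-- The alternating sum of the areas swept by the loop up to four parameters. -/
noncomputable def alternatingArea (γ : ℝ → ℂ) (s : Fin 4 → ℝ) : ℝ :=
  areaIntegral γ 0 (s 0) - areaIntegral γ 0 (s 1) + areaIntegral γ 0 (s 2) - areaIntegral γ 0 (s 3)

namespace IsPiecewiseSmoothJordanLoop
variable {γ : ℝ → ℂ}

lemma eq_or_eq_add_one (hγ : IsPiecewiseSmoothJordanLoop γ) {x y : ℝ} (h : γ x = γ y)
    (h1 : y ≤ x) (h2 : x ≤ y + 1) : x = y ∨ x = y + 1 := by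
  obtain ⟨n, rfl⟩ := hγ.eq_iff.1 h
  have h3 : (0 : ℝ) ≤ n := by linarith
  have h4 : (n : ℝ) ≤ 1 := by linarith
  have h3 : 0 ≤ n := by exact_mod_cast h3
  have h4 : n ≤ 1 := by exact_mod_cast h4
  obtain rfl | rfl : n = 0 ∨ n = 1 := by omega
  · simp
  · simp

/-- The second side vanishes, so `R 1 = R 2` and `R 3 = R 0`. The cyclic order and `R 0 ≠ R 1` force
`s 2 = s 1` but `s 3 = s 0 + 1`: one full turn is left over. -/
lemma alternatingArea_of_onXAxis (hγ : IsPiecewiseSmoothJordanLoop γ) {R : Fin 4 → ℂ}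
    {s : Fin 4 → ℝ} (hs : ∀ j, γ (s j) = R j) (hR : R 1 - R 0 = R 2 - R 3)
    (h01 : s 0 ≤ s 1) (h12 : s 1 ≤ s 2) (h23 : s 2 ≤ s 3) (h30 : s 3 ≤ s 0 + 1)
    (hX : OnXAxis (shape R)) : alternatingArea γ s = -areaIntegral γ 0 1 := by
  have hne : R 0 ≠ R 1 := dist_pos.1 hX.1
  have heq : R 1 = R 2 := dist_eq_zero.1 hX.2
  have heq' : R 3 = R 0 := by linear_combination hR - heq
  have hs01 : s 0 ≠ s 1 := fun h => hne (by rw [← hs, ← hs, h])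
  have h2 : s 2 = s 1 := by
    refine (hγ.eq_or_eq_add_one (by rw [hs, hs, heq]) h12 (by linarith)).resolve_right fun h => ?_
    exact hs01 (by linarith)
  have h3 : s 3 = s 0 + (1 : ℤ) := by
    rw [Int.cast_one]
    refine (hγ.eq_or_eq_add_one (by rw [hs, hs, heq']) (by linarith) h30).resolve_left fun h => ?_
    exact hs01 (by linarith)
  rw [alternatingArea, h2, h3, hγ.areaIntegral_add_int]
  push_cast
  ring

/-- Here the cyclic order forces `s 1 = s 0` and `s 3 = s 2`, so no turn is left over. -/
lemma alternatingArea_of_onYAxis (hγ : IsPiecewiseSmoothJordanLoop γ) {R : Fin 4 → ℂ}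
    {s : Fin 4 → ℝ} (hs : ∀ j, γ (s j) = R j) (hR : R 1 - R 0 = R 2 - R 3)
    (h01 : s 0 ≤ s 1) (h12 : s 1 ≤ s 2) (h23 : s 2 ≤ s 3) (h30 : s 3 ≤ s 0 + 1)
    (hY : OnYAxis (shape R)) : alternatingArea γ s = 0 := by
  have hne : R 1 ≠ R 2 := dist_pos.1 hY.2
  have heq : R 0 = R 1 := dist_eq_zero.1 hY.1
  have heq' : R 3 = R 2 := by linear_combination hR + heq
  have hs12 : s 1 ≠ s 2 := fun h => hne (by rw [← hs, ← hs, h])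
  have h1 : s 1 = s 0 := by
    refine (hγ.eq_or_eq_add_one (by rw [hs, hs, heq]) h01 (by linarith)).resolve_right fun h => ?_
    exact hs12 (by linarith)
  have h3 : s 3 = s 2 := by
    refine (hγ.eq_or_eq_add_one (by rw [hs, hs, heq']) h23 (by linarith)).resolve_right fun h => ?_
    exact hs12 (by linarith)
  rw [alternatingArea, h1, h3]
  ring

/-- Both parameter systems fit in one period after their first entry, so they differ by one common
integer, whose contribution cancels in the alternating sum. -/
lemma alternatingArea_eq_of_isRectangle (hγ : IsPiecewiseSmoothJordanLoop γ) {R : Fin 4 → ℂ}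
    (hR : IsRectangle R) {s s' : Fin 4 → ℝ} (hs : ∀ j, γ (s j) = R j) (hs' : ∀ j, γ (s' j) = R j)
    (h : s 0 ≤ s 1 ∧ s 1 ≤ s 2 ∧ s 2 ≤ s 3 ∧ s 3 ≤ s 0 + 1)
    (h' : s' 0 ≤ s' 1 ∧ s' 1 ≤ s' 2 ∧ s' 2 ≤ s' 3 ∧ s' 3 ≤ s' 0 + 1) :
    alternatingArea γ s = alternatingArea γ s' := by
  have hlt : ∀ u : Fin 4 → ℝ, (∀ j, γ (u j) = R j) → u 0 ≤ u 1 → u 1 ≤ u 2 → u 0 < u 1 ∧ u 1 < u 2 :=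
    fun u hu h1 h2 => ⟨lt_of_le_of_ne h1 fun h => hR.first_ne (by rw [← hu, ← hu, h]),
      lt_of_le_of_ne h2 fun h => hR.second_ne (by rw [← hu, ← hu, h])⟩
  obtain ⟨h01, h12⟩ := hlt s hs h.1 h.2.1
  obtain ⟨h01', h12'⟩ := hlt s' hs' h'.1 h'.2.1
  have hR23 : R 2 ≠ R 3 := fun e => hR.first_ne (by
    linear_combination -hR.parallelogram - e)
  have h23 := lt_of_le_of_ne h.2.2.1 fun e => hR23 (by rw [← hs, ← hs, e])
  have h23' := lt_of_le_of_ne h'.2.2.1 fun e => hR23 (by rw [← hs', ← hs', e])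
  have hm : ∀ j, ∃ n : ℤ, s j = s' j + n := fun j => hγ.eq_iff.1 ((hs j).trans (hs' j).symm)
  choose m hm using hm
  -- The difference of two numbers in `(0, 1]` lies strictly between `-1` and `1`; being an integer,
  -- it is `0`.
  have hm0 : ∀ j, 0 < s j - s 0 → s j - s 0 ≤ 1 → 0 < s' j - s' 0 → s' j - s' 0 ≤ 1 →
      m j = m 0 := fun j h1 h2 h3 h4 => by
    have h5 := hm j
    have h6 := hm 0
    have h7 : ((m j - m 0 : ℤ) : ℝ) < 1 := by push_cast; linarith
    have h8 : (-1 : ℝ) < ((m j - m 0 : ℤ) : ℝ) := by push_cast; linarith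
    have h7 : m j - m 0 < 1 := by exact_mod_cast h7
    have h8 : -1 < m j - m 0 := by exact_mod_cast h8
    omega
  have h30 := h.2.2.2
  have h30' := h'.2.2.2
  have e1 := hm0 1 (by linarith) (by linarith) (by linarith) (by linarith)
  have e2 := hm0 2 (by linarith) (by linarith) (by linarith) (by linarith)
  have e3 := hm0 3 (by linarith) (by linarith) (by linarith) (by linarith)
  simp only [alternatingArea]
  rw [hm 0, hm 1, hm 2, hm 3, e1, e2, e3, hγ.areaIntegral_add_int, hγ.areaIntegral_add_int,
    hγ.areaIntegral_add_int, hγ.areaIntegral_add_int]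
  ring

end IsPiecewiseSmoothJordanLoop

/-! ### The shape loops and the theorem -/

namespace IsGracingPath
variable {γ : ℝ → ℂ} {α : ℝ → Fin 4 → ℂ}

/-- The area swept by the shape curve depends only on the end positions of the vertices. -/
lemma exists_areaIntegral_eq_alternatingArea (hα : IsGracingPath γ α)
    (hγ : IsPiecewiseSmoothJordanLoop γ) : ∃ (ε : ℝ) (s : Fin 4 → ℝ → ℝ), ε ^ 2 = 1 ∧
      (∀ j, ∀ t ∈ Icc (0 : ℝ) 1, γ (s j t) = α t j) ∧
      (∀ t ∈ Icc (0 : ℝ) 1, s 0 t ≤ s 1 t ∧ s 1 t ≤ s 2 t ∧ s 2 t ≤ s 3 t ∧ s 3 t ≤ s 0 t + 1) ∧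
      areaIntegral (shapeCurve α) 0 1 =
        ε * (alternatingArea γ (fun j => s j 1) - alternatingArea γ (fun j => s j 0)) := by
  obtain ⟨ε, hε, harea⟩ := hα.exists_areaIntegral_shapeCurve
  obtain ⟨s, hsc, hs, hord⟩ := hα.exists_parameters hγ
  refine ⟨ε, s, hε, hs, hord, ?_⟩
  have hj : ∀ j, areaIntegral (fun t => α t j) 0 1 =
      areaIntegral γ 0 (s j 1) - areaIntegral γ 0 (s j 0) := fun j => by
    rw [(hα.almostC1On_apply j).areaIntegral_comp hγ.almostC1On (hsc j).continuousOn
      (fun t ht => by rw [uIcc_of_le zero_le_one] at ht; exact (hs j t ht).symm),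
      ← (hγ.almostC1On 0 (s j 0)).areaIntegral_add (hγ.almostC1On (s j 0) (s j 1))]
    ring
  rw [harea, hj, hj, hj, hj, alternatingArea, alternatingArea]
  ring

/-- By `h` the closing segment lies on a line through the origin, so only the shape curve sweeps
area. -/
lemma boundsSignedArea_nullShapeLoop (hα : IsGracingPath γ α)
    (h : (shapeCurve α 0 * starRingEnd ℂ (shapeCurve α 1)).im = 0) :
    BoundsSignedArea (nullShapeLoop α) 0 2 (areaIntegral (shapeCurve α) 0 1 / 2) := by
  have e1 : EqOn (nullShapeLoop α) (shapeCurve α) (Icc 0 1) := fun t ht => if_pos ht.2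
  have e2 : EqOn (nullShapeLoop α)
      (fun t => AffineMap.lineMap (shapeCurve α 1) (shapeCurve α 0) (t - 1)) (Icc 1 2) := by
    intro t ht
    rcases ht.1.eq_or_lt with rfl | hlt
    · simp [nullShapeLoop]
    · exact if_neg (not_le.2 hlt)
  have c1 := hα.almostC1On_shapeCurve.congr zero_le_one e1
  have c2 := (almostC1On_lineMap (shapeCurve α 1) (shapeCurve α 0) 1 1 2).congr one_le_two e2
  have key := (c1.trans c2 zero_le_one one_le_two).boundsSignedArea_areaIntegral (by
    rw [e1 (left_mem_Icc.2 zero_le_one), e2 (right_mem_Icc.2 one_le_two)]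
    norm_num)
  rwa [← c1.areaIntegral_add c2, areaIntegral_congr zero_le_one e1,
    areaIntegral_congr one_le_two e2, areaIntegral_lineMap h, add_zero] at key

lemma boundsSignedArea_hyperbolicShapeLoop (hα : IsGracingPath γ α) :
    BoundsSignedArea (hyperbolicShapeLoop α) 0 3 (areaIntegral (shapeCurve α) 0 1 / 2) := by
  have h23 : (2 : ℝ) ≤ 3 := by norm_num
  have e1 : EqOn (hyperbolicShapeLoop α) (shapeCurve α) (Icc 0 1) := fun t ht => if_pos ht.2
  have e2 : EqOn (hyperbolicShapeLoop α)
      (fun t => AffineMap.lineMap (shapeCurve α 1) 0 (t - 1)) (Icc 1 2) := by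
    intro t ht
    rcases ht.1.eq_or_lt with rfl | hlt
    · simp [hyperbolicShapeLoop]
    · exact (if_neg (not_le.2 hlt)).trans (if_pos ht.2)
  have e3 : EqOn (hyperbolicShapeLoop α)
      (fun t => AffineMap.lineMap 0 (shapeCurve α 0) (t - 2)) (Icc 2 3) := by
    intro t ht
    rcases ht.1.eq_or_lt with rfl | hlt
    · rw [e2 (right_mem_Icc.2 one_le_two)]
      norm_num
    · exact (if_neg (not_le.2 (one_lt_two.trans hlt))).trans (if_neg (not_le.2 hlt))
  have c1 := hα.almostC1On_shapeCurve.congr zero_le_one e1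
  have c2 := (almostC1On_lineMap (shapeCurve α 1) 0 1 1 2).congr one_le_two e2
  have c3 := (almostC1On_lineMap 0 (shapeCurve α 0) 2 2 3).congr h23 e3
  have c12 := c1.trans c2 zero_le_one one_le_two
  have key := (c12.trans c3 zero_le_two h23).boundsSignedArea_areaIntegral (by
    rw [e1 (left_mem_Icc.2 zero_le_one), e3 (right_mem_Icc.2 h23)]
    norm_num)
  rwa [← c12.areaIntegral_add c3, ← c1.areaIntegral_add c2, areaIntegral_congr zero_le_one e1,
    areaIntegral_congr one_le_two e2, areaIntegral_congr h23 e3,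
    areaIntegral_lineMap (by simp), areaIntegral_lineMap (by simp), add_zero, add_zero] at key

end IsGracingPath

theorem theorem1p3 (γ : ℝ → ℂ) (hγ : IsPiecewiseSmoothJordanLoop γ) (α : ℝ → Fin 4 → ℂ) :
    (IsHyperbolicArc γ α →
      ∃ A : ℝ, BoundsSignedArea (hyperbolicShapeLoop α) 0 3 A ∧
        ENNReal.ofReal |A| = volume (boundedRegion (range γ))) ∧
    (IsNullArc γ α → BoundsSignedArea (nullShapeLoop α) 0 2 0) ∧
    (IsGracingLoop γ α → BoundsSignedArea (shapeCurve α) 0 1 0) := by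
  have h0 : (0 : ℝ) ∈ Icc (0 : ℝ) 1 := left_mem_Icc.2 zero_le_one
  have h1 : (1 : ℝ) ∈ Icc (0 : ℝ) 1 := right_mem_Icc.2 zero_le_one
  refine ⟨fun ⟨hα, hends⟩ => ?_, fun ⟨hα, hends⟩ => ?_, fun ⟨hα, hgr, hloop⟩ => ?_⟩
  all_goals
    obtain ⟨ε, s, hε, hs, hord, harea⟩ := hα.exists_areaIntegral_eq_alternatingArea hγ
    have hX : ∀ t ∈ Icc (0 : ℝ) 1, OnXAxis (shape (α t)) → _ := fun t ht =>
      hγ.alternatingArea_of_onXAxis (s := fun j => s j t) (fun j => hs j t ht)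
        (hα.parallelogram t ht) (hord t ht).1 (hord t ht).2.1 (hord t ht).2.2.1 (hord t ht).2.2.2
    have hY : ∀ t ∈ Icc (0 : ℝ) 1, OnYAxis (shape (α t)) → _ := fun t ht =>
      hγ.alternatingArea_of_onYAxis (s := fun j => s j t) (fun j => hs j t ht)
        (hα.parallelogram t ht) (hord t ht).1 (hord t ht).2.1 (hord t ht).2.2.1 (hord t ht).2.2.2
  · refine ⟨_, hα.boundsSignedArea_hyperbolicShapeLoop, ?_⟩
    have habs : |ε| = 1 := by rcases sq_eq_one_iff.1 hε with rfl | rfl <;> simp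
    rw [← hγ.ofReal_abs_areaIntegral, harea]
    congr 1
    rcases hends with ⟨hx, hy⟩ | ⟨hy, hx⟩
    · rw [hX 0 h0 hx, hY 1 h1 hy, zero_sub, neg_neg, mul_div_assoc, abs_mul, habs, one_mul]
    · rw [hX 1 h1 hx, hY 0 h0 hy, sub_zero, mul_div_assoc, abs_mul, habs, one_mul, neg_div, abs_neg]
  · have hzero : areaIntegral (shapeCurve α) 0 1 / 2 = 0 := by
      rcases hends with ⟨hx, hx'⟩ | ⟨hy, hy'⟩
      · rw [harea, hX 0 h0 hx, hX 1 h1 hx', sub_self, mul_zero, zero_div]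
      · rw [harea, hY 0 h0 hy, hY 1 h1 hy', sub_self, mul_zero, zero_div]
    have haxis : (shapeCurve α 0 * starRingEnd ℂ (shapeCurve α 1)).im = 0 := by
      rcases hends with ⟨hx, hx'⟩ | ⟨hy, hy'⟩
      · simp [shapeCurve, hx.2, hx'.2]
      · simp [shapeCurve, hy.1, hy'.1]
    have key := hα.boundsSignedArea_nullShapeLoop haxis
    rwa [hzero] at key
  -- The final parameters may be the initial ones moved by whole turns, which `alternatingArea` does
  -- not see.
  · have hzero : areaIntegral (shapeCurve α) 0 1 / 2 = 0 := by
      rw [harea, hγ.alternatingArea_eq_of_isRectangle hgr.1 (fun j => (hs j 1 h1).trans (by rw [hloop]))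
        (fun j => hs j 0 h0) (hord 1 h1) (hord 0 h0), sub_self, mul_zero, zero_div]
    have key := hα.almostC1On_shapeCurve.boundsSignedArea_areaIntegral (by simp only [shapeCurve, hloop])
    rwa [hzero] at key
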